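/- Work in classical first-order logic in the language $\{0,S,+,\times,\leqslant\}$ of arithmetic; $\overline m$ is the numeral $S\cdots S0$ of $m\in\mathbb N$, and Gödel numbers refer to a fixed standard Gödel numbering. Let $\mathsf Q$ be Robinson's arithmetic. Let $\Sigma_0=\Pi_0$ be the class of bounded formulas, and let $\Sigma_{k+1}$ be the least class that contains $\Pi_k$ and is closed under conjunction, disjunction, existential quantifiers and bounded universal quantifiers; dually, $\Pi_{k+1}$ contains $\Sigma_k$ and is closed under conjunction, disjunction, universal quantifiers and bounded existential quantifiers; negation interchanges $\Sigma_k$ and $\Pi_k$. Let $T$ be a theory given by a set of axioms. - $T$ is an extension of $\mathsf Q$ if it proves every axiom of $\mathsf Q$. - $T$ is $\Sigma_n$-definable if the set of Gödel numbers of its axioms is defined in the standard model $\mathbb N$ by a $\Sigma_n$-formula with one free variable. - For $k\geqslant 1$, $T$ is $k$-consistent if there is no $\Pi_{k-1}$-formula $\psi(x)$ such that $T\vdash\exists x\,\psi(x)$ and $T\vdash\neg\psi(\overline m)$ for every $m\in\mathbb N$; $T$ is $0$-consistent if it is consistent. - $T$ is $\Pi_n$-deciding if for every $\Pi_n$-sentence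 $\varphi$, $T\vdash\varphi$ or $T\vdash\neg\varphi$. **Theorem.** Let $n\geqslant 1$. No $\Sigma_n$-definable extension of $\mathsf Q$ that is $(n-1)$-consistent is $\Pi_n$-deciding. -/

import Mathlib

namespace Arith

open FirstOrder.Language

/-- Function symbols of the language of arithmetic `{0, S, +, ×, ≤}`. -/
inductive Func : ℕ → Type
  | zero : Func 0
  | succ : Func 1
  | add : Func 2
  | mul : Func 2

/-- Relation symbols of the language of arithmetic `{0, S, +, ×, ≤}`. -/
inductive Rel : ℕ → Type
  | le : Rel 2

/-- The language of arithmetic `{0, S, +, ×, ≤}`. -/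
abbrev L : FirstOrder.Language.{0, 0} := ⟨Func, Rel⟩

/-- Terms whose variables are among `x₀, …, xₙ₋₁`. -/
abbrev Tm (n : ℕ) : Type := L.Term (Empty ⊕ Fin n)

/-- Formulas whose free variables are among `x₀, …, xₙ₋₁`. A quantifier in front of a formula of
`Fm (n + 1)` binds `xₙ`, and `Fm 0` is the type `L.Sentence` of sentences. -/
abbrev Fm (n : ℕ) : Type := L.BoundedFormula Empty n

/-- The standard model. -/
instance standardModel : L.Structure ℕ where
  funMap f v :=
    match f, v with
    | .zero, _ => 0
    | .succ, v => v 0 + 1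
    | .add, v => v 0 + v 1
    | .mul, v => v 0 * v 1
  RelMap r v :=
    match r, v with
    | .le, v => v 0 ≤ v 1

section Syntax_of_arithmetic

variable {n : ℕ}

/-- The variable `xᵢ`. -/
def x (i : Fin n) : Tm n := Term.var (Sum.inr i)

def zero : Tm n := Term.func Func.zero ![]

def succ (t : Tm n) : Tm n := Term.func Func.succ ![t]

def add (s t : Tm n) : Tm n := Term.func Func.add ![s, t]

def mul (s t : Tm n) : Tm n := Term.func Func.mul ![s, t]

def eq (s t : Tm n) : Fm n := BoundedFormula.equal s t

def le (s t : Tm n) : Fm n := BoundedFormula.rel Rel.le ![s, t]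

/-- The numeral `S ⋯ S 0` with `m` occurrences of `S`. -/
def numeral : ℕ → Tm n
  | 0 => zero
  | m + 1 => succ (numeral m)

/-- A term in `x₀, …, xₙ₋₁`, seen as a term in `x₀, …, xₙ`. -/
def liftTm (t : Tm n) : Tm (n + 1) := t.relabel (Sum.map id Fin.castSucc)

/-- Simultaneous substitution of the term `f i` for the variable `xᵢ` in a term. -/
def substTm {m : ℕ} (t : Tm m) (f : Fin m → Tm n) : Tm n :=
  t.subst (Sum.elim Empty.elim f)

end Syntax_of_arithmetic

/-- Simultaneous (capture-avoiding) substitution of the term `f i` for the free variable `xᵢ`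
in a formula. -/
def subst : ∀ {m n : ℕ}, Fm m → (Fin m → Tm n) → Fm n
  | _, _, .falsum, _ => .falsum
  | _, _, .equal s t, f => .equal (substTm s f) (substTm t f)
  | _, _, .rel R ts, f => .rel R fun i => substTm (ts i) f
  | _, _, .imp φ ψ, f => .imp (subst φ f) (subst ψ f)
  | _, n, .all φ, f => .all (subst φ (Fin.snoc (fun i => liftTm (f i)) (x (Fin.last n))))

/-- A formula in `x₀, …, xₙ₋₁`, seen as a formula in `x₀, …, xₙ`. -/
def lift {n : ℕ} (φ : Fm n) : Fm (n + 1) := subst φ fun i => x i.castSucc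

/-- `φ(x₀, …, xₙ₋₁, t)`: the instance of `φ(x₀, …, xₙ)` in which `t` replaces `xₙ`. -/
def inst {n : ℕ} (φ : Fm (n + 1)) (t : Tm n) : Fm n := subst φ (Fin.snoc x t)

/-- Provability from the set `T` of axioms in a Hilbert calculus for classical first-order logic
with equality. (Negation, conjunction, disjunction and the existential quantifier are Mathlib's
abbreviations in terms of `⊥`, `→` and `∀`.) -/
inductive Provable (T : L.Theory) : ∀ {n : ℕ}, Fm n → Prop
  | ax {n : ℕ} (σ : L.Sentence) : σ ∈ T → Provable T (subst (n := n) σ Fin.elim0)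
  | imp_intro {n : ℕ} (φ ψ : Fm n) : Provable T (φ.imp (ψ.imp φ))
  | imp_distrib {n : ℕ} (φ ψ χ : Fm n) :
      Provable T ((φ.imp (ψ.imp χ)).imp ((φ.imp ψ).imp (φ.imp χ)))
  | not_not {n : ℕ} (φ : Fm n) : Provable T (φ.not.not.imp φ)
  | all_inst {n : ℕ} (φ : Fm (n + 1)) (t : Tm n) : Provable T (φ.all.imp (inst φ t))
  | all_imp {n : ℕ} (φ ψ : Fm (n + 1)) :
      Provable T ((φ.imp ψ).all.imp (φ.all.imp ψ.all))
  | all_intro {n : ℕ} (φ : Fm n) : Provable T (φ.imp (lift φ).all)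
  | eq_refl {n : ℕ} (t : Tm n) : Provable T (eq t t)
  | eq_subst {n : ℕ} (s t : Tm n) (φ : Fm (n + 1)) :
      Provable T ((eq s t).imp ((inst φ s).imp (inst φ t)))
  | mp {n : ℕ} {φ ψ : Fm n} : Provable T (φ.imp ψ) → Provable T φ → Provable T ψ
  | gen {n : ℕ} {φ : Fm (n + 1)} : Provable T φ → Provable T φ.all

/-- Robinson's arithmetic `Q`. -/
def Q : L.Theory :=
  { -- `∀ x, S x ≠ 0`
    (eq (succ (x 0)) zero : Fm 1).not.all,
    -- `∀ x y, S x = S y → x = y`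
    ((eq (succ (x 0)) (succ (x 1)) : Fm 2).imp (eq (x 0) (x 1))).all.all,
    -- `∀ x, x ≠ 0 → ∃ y, x = S y`
    ((eq (x 0) zero : Fm 1).not.imp (eq (x 0) (succ (x 1)) : Fm 2).ex).all,
    -- `∀ x, x + 0 = x`
    (eq (add (x 0) zero) (x 0) : Fm 1).all,
    -- `∀ x y, x + S y = S (x + y)`
    (eq (add (x 0) (succ (x 1))) (succ (add (x 0) (x 1))) : Fm 2).all.all,
    -- `∀ x, x × 0 = 0`
    (eq (mul (x 0) zero) zero : Fm 1).all,
    -- `∀ x y, x × S y = x × y + x`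
    (eq (mul (x 0) (succ (x 1))) (add (mul (x 0) (x 1)) (x 0)) : Fm 2).all.all,
    -- `∀ x y, x ≤ y ↔ ∃ z, z + x = y`
    ((le (x 0) (x 1) : Fm 2).iff (eq (add (x 2) (x 0)) (x 1) : Fm 3).ex).all.all }

/-- The bounded quantifier `∀ xₙ ≤ t`, where `xₙ` does not occur in `t`. -/
def ball {n : ℕ} (t : Tm n) (φ : Fm (n + 1)) : Fm n :=
  ((le (x (Fin.last n)) (liftTm t)).imp φ).all

/-- The bounded quantifier `∃ xₙ ≤ t`, where `xₙ` does not occur in `t`. -/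
def bex {n : ℕ} (t : Tm n) (φ : Fm (n + 1)) : Fm n :=
  (le (x (Fin.last n)) (liftTm t) ⊓ φ).ex

/-- Bounded formulas: all quantifiers are bounded. -/
inductive IsBounded : ∀ {n : ℕ}, Fm n → Prop
  | falsum {n : ℕ} : IsBounded (.falsum : Fm n)
  | eq {n : ℕ} (s t : Tm n) : IsBounded (eq s t)
  | le {n : ℕ} (s t : Tm n) : IsBounded (le s t)
  | imp {n : ℕ} {φ ψ : Fm n} : IsBounded φ → IsBounded ψ → IsBounded (φ.imp ψ)
  | ball {n : ℕ} (t : Tm n) {φ : Fm (n + 1)} : IsBounded φ → IsBounded (ball t φ)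
  | bex {n : ℕ} (t : Tm n) {φ : Fm (n + 1)} : IsBounded φ → IsBounded (bex t φ)

/-- The two kinds of classes in the arithmetical hierarchy. -/
inductive Kind
  | sigma
  | pi

/-- `Σ` and `Π` are dual to each other. -/
def Kind.dual : Kind → Kind
  | .sigma => .pi
  | .pi => .sigma

/-- `InClass .sigma k φ` says that `φ` is a `Σₖ`-formula, and `InClass .pi k φ` that `φ` is a
`Πₖ`-formula. `Σ₀ = Π₀` is the class of bounded formulas; `Σₖ₊₁` contains `Πₖ` and is closed under
`∃`, under `∀ x ≤ t`, and under the rule that `φ → ψ` is `Σₖ₊₁` if `φ` is `Πₖ₊₁` and `ψ` is `Σₖ₊₁`;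
dually for `Πₖ₊₁`. The rule for `→` includes the closure under `∧` and `∨` and the
fact that negation interchanges `Σₖ₊₁` and `Πₖ₊₁`, as these connectives abbreviate formulas in
`→` and `⊥`. -/
inductive InClass : Kind → ℕ → ∀ {n : ℕ}, Fm n → Prop
  | bounded {Γ : Kind} {n : ℕ} {φ : Fm n} : IsBounded φ → InClass Γ 0 φ
  | of_dual {Γ : Kind} {k n : ℕ} {φ : Fm n} : InClass Γ.dual k φ → InClass Γ (k + 1) φ
  | imp {Γ : Kind} {k n : ℕ} {φ ψ : Fm n} :
      InClass Γ.dual (k + 1) φ → InClass Γ (k + 1) ψ → InClass Γ (k + 1) (φ.imp ψ)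
  | ex {k n : ℕ} {φ : Fm (n + 1)} : InClass .sigma (k + 1) φ → InClass .sigma (k + 1) φ.ex
  | all {k n : ℕ} {φ : Fm (n + 1)} : InClass .pi (k + 1) φ → InClass .pi (k + 1) φ.all
  | ball {k n : ℕ} (t : Tm n) {φ : Fm (n + 1)} :
      InClass .sigma (k + 1) φ → InClass .sigma (k + 1) (ball t φ)
  | bex {k n : ℕ} (t : Tm n) {φ : Fm (n + 1)} :
      InClass .pi (k + 1) φ → InClass .pi (k + 1) (bex t φ)

/-- Gödel numbers of terms. -/
def codeTm {n : ℕ} : Tm n → ℕ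
  | .var (.inl e) => e.elim
  | .var (.inr i) => Nat.pair 0 i
  | .func .zero _ => Nat.pair 1 0
  | .func .succ ts => Nat.pair 2 (codeTm (ts 0))
  | .func .add ts => Nat.pair 3 (Nat.pair (codeTm (ts 0)) (codeTm (ts 1)))
  | .func .mul ts => Nat.pair 4 (Nat.pair (codeTm (ts 0)) (codeTm (ts 1)))

/-- Gödel numbers of formulas. -/
def code : ∀ {n : ℕ}, Fm n → ℕ
  | _, .falsum => Nat.pair 0 0
  | _, .equal s t => Nat.pair 1 (Nat.pair (codeTm s) (codeTm t))
  | _, .rel .le ts => Nat.pair 2 (Nat.pair (codeTm (ts 0)) (codeTm (ts 1)))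
  | _, .imp φ ψ => Nat.pair 3 (Nat.pair (code φ) (code ψ))
  | _, .all φ => Nat.pair 4 (code φ)

/-- The theory axiomatized by `T` is `Γₖ`-definable: a `Γₖ`-formula with one free variable defines,
in the standard model, the set of Gödel numbers of the axioms. -/
def Definable (Γ : Kind) (k : ℕ) (T : L.Theory) : Prop :=
  ∃ θ : Fm 1, InClass Γ k θ ∧
    ∀ m : ℕ, θ.Realize (default : Empty → ℕ) ![m] ↔ ∃ σ ∈ T, code (n := 0) σ = m

/-- `T` is an extension of `S`: every axiom of `S` is a theorem of `T`. -/
def Extends (T S : L.Theory) : Prop := ∀ σ ∈ S, Provable T (n := 0) σ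

/-- `T` is `Γₖ`-deciding: it proves or refutes every `Γₖ`-sentence. -/
def Deciding (Γ : Kind) (k : ℕ) (T : L.Theory) : Prop :=
  ∀ φ : Fm 0, InClass Γ k φ → Provable T φ ∨ Provable T φ.not

/-- `T` is consistent. -/
def Consistent (T : L.Theory) : Prop := ¬ Provable T (n := 0) .falsum

/-- `T` is `k`-consistent. For `k ≥ 1` this says that there is no `Πₖ₋₁`-formula `ψ(x)` such that
`T` proves `∃ x ψ(x)` and also `¬ψ(m)` for every numeral `m`; `0`-consistency is consistency. -/
def NConsistent : ℕ → L.Theory → Prop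
  | 0, T => Consistent T
  | k + 1, T => ¬ ∃ ψ : Fm 1, InClass .pi k ψ ∧
      (∀ m : ℕ, Provable T (inst ψ (numeral m)).not) ∧ Provable T ψ.ex

end Arith

/-!
Rosser's argument, at level `n = k + 1` of the arithmetical hierarchy. Suppose that `T` is
`Σₖ₊₁`-definable, extends `Q`, is `k`-consistent, and decides all `Πₖ₊₁`-sentences.

*Correctness up to level `k`.* The theory `T` decides the prenex `Σⱼ`- and `Πⱼ`-sentences correctly
for `j ≤ k` (`Strict.decides`). For bounded sentences this is provability in `Q`
(`IsBounded.decides`). If `∃ x ψ(x)` is false for a prenex `Πⱼ`-formula `ψ` with `j < k`, then `T`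
refutes all numerical instances of `ψ`, so by `k`-consistency it does not prove `∃ x ψ(x)`, and so,
deciding this sentence, it refutes it. Prenex formulas with single quantifiers are used because
induction and pairing are not available in `T`; for the formulas in question this is no loss, as
they only have to define a given set in the standard model.

*Definability.* The sets `{φ | T ⊢ φ(⌜φ⌝)}` and `{φ | T ⊢ ¬φ(⌜φ⌝)}` are `Σₖ₊₁` in the standard
model. To see this, the arithmetical hierarchy is built over the primitive recursive predicates
(`Sig`), where Mathlib's theory of `Primrec` is at hand. A set that is inductively generated by a
`Σₖ₊₁`-relation is `Σₖ₊₁` (`Sig.gen`), and the substitution of terms and provability are generated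
in this way (`gen_fmStep_iff`, `gen_prStep_iff`). Conversely, every `Σₖ₊₁`-predicate is defined by a
prenex formula (`Sig.exists_strict`), because Gödel's beta function gives `Σ₁`-definitions of the
primitive recursive functions. Thus the two sets are defined by `∃ z π₁(x, z)` and `∃ w π₂(x, w)`
with prenex `Πₖ`-formulas `π₁` and `π₂`, whose numerical instances `T` decides correctly.

*The Rosser sentence.* Let `ρ(x)` be `∀ z (π₁(x, z) → ∃ w ≤ z π₂(x, w))`, which is a `Πₖ₊₁`-formula,
and let `e` be its Gödel number. As `π₁` and `π₂` refer to the provability of the instance of `x` at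
`x`, no diagonal lemma inside `T` is needed: `ρ(e)` is provable if and only if `∃ z π₁(e, z)` is
true, and refutable if and only if `∃ w π₂(e, w)` is true. If `T` proves `ρ(e)`, then it proves
`π₁(e, z)` for some numeral `z` and refutes `π₂(e, w)` for all `w ≤ z`, so it refutes `ρ(e)`. If it
refutes `ρ(e)`, then it proves `π₂(e, w)` for some numeral `w` and refutes `π₁(e, z)` for all
`z ≤ w`; since `Q` proves that every `z` is comparable with `w`, it proves `ρ(e)`. Either way `T` is
inconsistent.
-/

namespace Arith

open FirstOrder.Language

/-! ### Substitution -/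

section Substitution

variable {m n p : ℕ}

@[simp] theorem substTm_x (i : Fin m) (f : Fin m → Tm n) : substTm (x i) f = f i := rfl

@[simp] theorem substTm_zero (f : Fin m → Tm n) : substTm zero f = zero := by
  simp only [substTm, zero, Term.subst]
  congr 1
  exact Subsingleton.elim _ _

@[simp] theorem substTm_succ (t : Tm m) (f : Fin m → Tm n) :
    substTm (succ t) f = succ (substTm t f) := by
  simp only [substTm, succ, Term.subst]
  congr 1
  funext i
  fin_cases i; rfl

@[simp] theorem substTm_add (s t : Tm m) (f : Fin m → Tm n) :
    substTm (add s t) f = add (substTm s f) (substTm t f) := by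
  simp only [substTm, add, Term.subst]
  congr 1
  funext i
  fin_cases i <;> rfl

@[simp] theorem substTm_mul (s t : Tm m) (f : Fin m → Tm n) :
    substTm (mul s t) f = mul (substTm s f) (substTm t f) := by
  simp only [substTm, mul, Term.subst]
  congr 1
  funext i
  fin_cases i <;> rfl

@[simp] theorem substTm_numeral (k : ℕ) (f : Fin m → Tm n) :
    substTm (numeral k) f = numeral k := by
  induction k with
  | zero => exact substTm_zero f
  | succ k ih => simp [numeral, ih]

/-- Induction on terms of arithmetic. -/
theorem Tm.rec' {P : Tm m → Prop} (hx : ∀ i, P (x i)) (h0 : P zero)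
    (hs : ∀ t, P t → P (succ t)) (ha : ∀ s t, P s → P t → P (add s t))
    (hm : ∀ s t, P s → P t → P (mul s t)) (t : Tm m) : P t := by
  induction t with
  | var v =>
    rcases v with e | i
    · exact e.elim
    · exact hx i
  | func f ts ih =>
    cases f with
    | zero => rw [Subsingleton.elim ts ![]]; exact h0
    | succ =>
      have : ts = ![ts 0] := by funext i; fin_cases i; rfl
      rw [this]; exact hs _ (ih 0)
    | add =>
      have : ts = ![ts 0, ts 1] := by funext i; fin_cases i <;> rfl
      rw [this]; exact ha _ _ (ih 0) (ih 1)
    | mul =>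
      have : ts = ![ts 0, ts 1] := by funext i; fin_cases i <;> rfl
      rw [this]; exact hm _ _ (ih 0) (ih 1)

theorem liftTm_eq_substTm (t : Tm n) : liftTm t = substTm t fun i => x i.castSucc := by
  induction t with
  | var v =>
    rcases v with e | i
    · exact e.elim
    · rfl
  | func f ts ih =>
    simp only [liftTm, substTm, Term.relabel, Term.subst] at ih ⊢
    congr 1
    funext i
    exact ih i

theorem substTm_substTm (t : Tm m) (f : Fin m → Tm n) (g : Fin n → Tm p) :
    substTm (substTm t f) g = substTm t fun i => substTm (f i) g := by
  induction t using Tm.rec' <;> simp_all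

theorem substTm_id (t : Tm m) : substTm t x = t := by
  induction t using Tm.rec' <;> simp_all

/-- The assignment `f` of terms, extended under a quantifier. -/
def under (f : Fin m → Tm n) : Fin (m + 1) → Tm (n + 1) :=
  Fin.snoc (fun i => liftTm (f i)) (x (Fin.last n))

@[simp] theorem under_castSucc (f : Fin m → Tm n) (i : Fin m) :
    under f i.castSucc = liftTm (f i) := by simp [under]

@[simp] theorem under_last (f : Fin m → Tm n) : under f (Fin.last m) = x (Fin.last n) := by
  simp [under]

@[simp] theorem liftTm_x (i : Fin n) : liftTm (x i) = x i.castSucc := rfl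

@[simp] theorem substTm_liftTm (t : Tm m) (f : Fin (m + 1) → Tm n) :
    substTm (liftTm t) f = substTm t fun i => f i.castSucc := by
  simp [liftTm_eq_substTm, substTm_substTm]

theorem liftTm_substTm (t : Tm m) (f : Fin m → Tm n) :
    liftTm (substTm t f) = substTm t fun i => liftTm (f i) := by
  simp only [liftTm_eq_substTm, substTm_substTm]

@[simp] theorem liftTm_zero : liftTm (zero : Tm n) = zero := by simp [liftTm_eq_substTm]
@[simp] theorem liftTm_succ (t : Tm n) : liftTm (succ t) = succ (liftTm t) := by
  simp [liftTm_eq_substTm]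
@[simp] theorem liftTm_add (s t : Tm n) : liftTm (add s t) = add (liftTm s) (liftTm t) := by
  simp [liftTm_eq_substTm]
@[simp] theorem liftTm_mul (s t : Tm n) : liftTm (mul s t) = mul (liftTm s) (liftTm t) := by
  simp [liftTm_eq_substTm]
@[simp] theorem liftTm_numeral (k : ℕ) : liftTm (numeral k : Tm n) = numeral k := by
  simp [liftTm_eq_substTm]

@[simp] theorem subst_falsum (f : Fin m → Tm n) : subst (.falsum : Fm m) f = .falsum := by
  rw [subst]
@[simp] theorem subst_bot (f : Fin m → Tm n) : subst (⊥ : Fm m) f = ⊥ := by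
  exact subst_falsum f
@[simp] theorem subst_eq (s t : Tm m) (f : Fin m → Tm n) :
    subst (eq s t) f = eq (substTm s f) (substTm t f) := by
  simp only [eq, subst]
@[simp] theorem subst_le (s t : Tm m) (f : Fin m → Tm n) :
    subst (le s t) f = le (substTm s f) (substTm t f) := by
  simp only [le, subst]
  congr 1
  funext i
  fin_cases i <;> rfl
@[simp] theorem subst_imp (φ ψ : Fm m) (f : Fin m → Tm n) :
    subst (φ.imp ψ) f = (subst φ f).imp (subst ψ f) := by
  rw [subst]
@[simp] theorem subst_all (φ : Fm (m + 1)) (f : Fin m → Tm n) :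
    subst φ.all f = (subst φ (under f)).all := by
  rw [subst]; rfl
@[simp] theorem subst_not (φ : Fm m) (f : Fin m → Tm n) :
    subst φ.not f = (subst φ f).not := by
  simp [BoundedFormula.not]
@[simp] theorem subst_ex (φ : Fm (m + 1)) (f : Fin m → Tm n) :
    subst φ.ex f = (subst φ (under f)).ex := by
  simp [BoundedFormula.ex]
@[simp] theorem subst_inf (φ ψ : Fm m) (f : Fin m → Tm n) :
    subst (φ ⊓ ψ) f = subst φ f ⊓ subst ψ f := by
  change subst (φ.imp ψ.not).not f = ((subst φ f).imp (subst ψ f).not).not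
  simp
@[simp] theorem subst_ball (t : Tm m) (φ : Fm (m + 1)) (f : Fin m → Tm n) :
    subst (ball t φ) f = ball (substTm t f) (subst φ (under f)) := by
  simp [ball, liftTm_substTm]
@[simp] theorem subst_bex (t : Tm m) (φ : Fm (m + 1)) (f : Fin m → Tm n) :
    subst (bex t φ) f = bex (substTm t f) (subst φ (under f)) := by
  simp [bex, liftTm_substTm]

/-- Induction on formulas of arithmetic. -/
theorem Fm.rec' {P : ∀ {n : ℕ}, Fm n → Prop} (hf : ∀ {n}, P (.falsum : Fm n))
    (he : ∀ {n} (s t : Tm n), P (eq s t)) (hl : ∀ {n} (s t : Tm n), P (le s t))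
    (hi : ∀ {n} (φ ψ : Fm n), P φ → P ψ → P (φ.imp ψ))
    (ha : ∀ {n} (φ : Fm (n + 1)), P φ → P φ.all) {n : ℕ} (φ : Fm n) : P φ := by
  induction φ with
  | falsum => exact hf
  | equal s t => exact he s t
  | rel R ts =>
    cases R
    have : ts = ![ts 0, ts 1] := by funext i; fin_cases i <;> rfl
    rw [this]; exact hl _ _
  | imp φ ψ h1 h2 => exact hi _ _ h1 h2
  | all φ h => exact ha _ h

theorem substTm_under_under (f : Fin m → Tm n) (g : Fin n → Tm p) :
    (fun i => substTm (under f i) (under g)) = under fun i => substTm (f i) g := by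
  funext i
  refine Fin.lastCases ?_ (fun i => ?_) i <;> simp [liftTm_substTm]

theorem subst_subst (φ : Fm m) (f : Fin m → Tm n) (g : Fin n → Tm p) :
    subst (subst φ f) g = subst φ fun i => substTm (f i) g := by
  induction φ using Fm.rec' generalizing n p with
  | hf => simp
  | he s t => simp [substTm_substTm]
  | hl s t => simp [substTm_substTm]
  | hi φ ψ h1 h2 => simp [h1, h2]
  | ha φ h => simp [h, substTm_under_under]

theorem under_x : under (x : Fin n → Tm n) = x := by
  funext i
  refine Fin.lastCases ?_ (fun i => ?_) i <;> simp

theorem subst_id (φ : Fm m) : subst φ x = φ := by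
  induction φ using Fm.rec' with
  | hf => simp
  | he s t => simp [substTm_id]
  | hl s t => simp [substTm_id]
  | hi φ ψ h1 h2 => simp [h1, h2]
  | ha φ h => simp [under_x, h]

theorem subst_lift (φ : Fm m) (f : Fin (m + 1) → Tm n) :
    subst (lift φ) f = subst φ fun i => f i.castSucc := by
  simp [lift, subst_subst]

theorem lift_subst (φ : Fm m) (f : Fin m → Tm n) :
    lift (subst φ f) = subst φ fun i => liftTm (f i) := by
  simp only [lift, subst_subst, liftTm_eq_substTm]

theorem subst_lift_under (φ : Fm m) (f : Fin m → Tm n) :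
    subst (lift φ) (under f) = lift (subst φ f) := by
  simp [subst_lift, lift_subst]

theorem subst_inst (φ : Fm (m + 1)) (t : Tm m) (f : Fin m → Tm n) :
    subst (inst φ t) f = subst φ (Fin.snoc f (substTm t f)) := by
  rw [inst, subst_subst]
  congr 1
  funext i
  refine Fin.lastCases ?_ (fun i => ?_) i <;> simp

theorem inst_subst_under (φ : Fm (m + 1)) (t : Tm n) (f : Fin m → Tm n) :
    inst (subst φ (under f)) t = subst φ (Fin.snoc f t) := by
  rw [inst, subst_subst]
  congr 1
  funext i
  refine Fin.lastCases ?_ (fun i => ?_) i <;> simp [substTm_id]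

@[simp] theorem inst_imp (φ ψ : Fm (n + 1)) (t : Tm n) :
    inst (φ.imp ψ) t = (inst φ t).imp (inst ψ t) := by simp [inst]
@[simp] theorem inst_not (φ : Fm (n + 1)) (t : Tm n) : inst φ.not t = (inst φ t).not := by
  simp [inst]
@[simp] theorem inst_inf (φ ψ : Fm (n + 1)) (t : Tm n) :
    inst (φ ⊓ ψ) t = inst φ t ⊓ inst ψ t := by simp [inst]
@[simp] theorem inst_eq (s u : Tm (n + 1)) (t : Tm n) :
    inst (eq s u) t = eq (substTm s (Fin.snoc x t)) (substTm u (Fin.snoc x t)) := by simp [inst]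
@[simp] theorem inst_le (s u : Tm (n + 1)) (t : Tm n) :
    inst (le s u) t = le (substTm s (Fin.snoc x t)) (substTm u (Fin.snoc x t)) := by simp [inst]
@[simp] theorem substTm_liftTm_snoc (s t : Tm n) : substTm (liftTm s) (Fin.snoc x t) = s := by
  simp [substTm_id]

theorem inst_last_lift_under (φ : Fm (n + 1)) :
    inst (subst φ (under fun i => x i.castSucc)) (x (Fin.last n)) = φ := by
  rw [inst_subst_under]
  convert subst_id φ using 2
  funext i
  refine Fin.lastCases ?_ (fun i => ?_) i <;> simp

@[simp] theorem lift_falsum : lift (.falsum : Fm n) = .falsum := by simp [lift]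
@[simp] theorem lift_imp (φ ψ : Fm n) : lift (φ.imp ψ) = (lift φ).imp (lift ψ) := by simp [lift]
@[simp] theorem lift_not (φ : Fm n) : lift φ.not = (lift φ).not := by simp [lift]
@[simp] theorem lift_eq (s t : Tm n) : lift (eq s t) = eq (liftTm s) (liftTm t) := by
  simp [lift, liftTm_eq_substTm]
@[simp] theorem lift_le (s t : Tm n) : lift (le s t) = le (liftTm s) (liftTm t) := by
  simp [lift, liftTm_eq_substTm]

end Substitution

/-! ### The standard model -/

section Realize

variable {m n : ℕ}

/-- The value of a term in the standard model. -/
def val (t : Tm n) (v : Fin n → ℕ) : ℕ := t.realize (Sum.elim default v)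

/-- Truth of a formula in the standard model. -/
def Holds (φ : Fm n) (v : Fin n → ℕ) : Prop := φ.Realize (default : Empty → ℕ) v

@[simp] theorem val_x (i : Fin n) (v : Fin n → ℕ) : val (x i) v = v i := rfl
@[simp] theorem val_zero (v : Fin n → ℕ) : val zero v = 0 := rfl
@[simp] theorem val_succ (t : Tm n) (v : Fin n → ℕ) : val (succ t) v = val t v + 1 := rfl
@[simp] theorem val_add (s t : Tm n) (v : Fin n → ℕ) : val (add s t) v = val s v + val t v := rfl
@[simp] theorem val_mul (s t : Tm n) (v : Fin n → ℕ) : val (mul s t) v = val s v * val t v := rfl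
@[simp] theorem val_numeral (k : ℕ) (v : Fin n → ℕ) : val (numeral k) v = k := by
  induction k with
  | zero => rfl
  | succ k ih => simp [numeral, ih]

theorem val_substTm (t : Tm m) (f : Fin m → Tm n) (v : Fin n → ℕ) :
    val (substTm t f) v = val t fun i => val (f i) v := by
  induction t using Tm.rec' <;> simp_all

@[simp] theorem val_liftTm (t : Tm n) (v : Fin n → ℕ) (a : ℕ) :
    val (liftTm t) (Fin.snoc v a : Fin (n + 1) → ℕ) = val t v := by
  simp [liftTm_eq_substTm, val_substTm]

@[simp] theorem holds_falsum (v : Fin n → ℕ) : ¬ Holds .falsum v := id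
@[simp] theorem holds_eq (s t : Tm n) (v : Fin n → ℕ) :
    Holds (eq s t) v ↔ val s v = val t v := Iff.rfl
@[simp] theorem holds_le (s t : Tm n) (v : Fin n → ℕ) :
    Holds (le s t) v ↔ val s v ≤ val t v := Iff.rfl
@[simp] theorem holds_imp (φ ψ : Fm n) (v : Fin n → ℕ) :
    Holds (φ.imp ψ) v ↔ (Holds φ v → Holds ψ v) := Iff.rfl
@[simp] theorem holds_all (φ : Fm (n + 1)) (v : Fin n → ℕ) :
    Holds φ.all v ↔ ∀ a, Holds φ (Fin.snoc v a) := Iff.rfl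
@[simp] theorem holds_not (φ : Fm n) (v : Fin n → ℕ) : Holds φ.not v ↔ ¬ Holds φ v := Iff.rfl
@[simp] theorem holds_ex (φ : Fm (n + 1)) (v : Fin n → ℕ) :
    Holds φ.ex v ↔ ∃ a, Holds φ (Fin.snoc v a) := BoundedFormula.realize_ex
@[simp] theorem holds_inf (φ ψ : Fm n) (v : Fin n → ℕ) :
    Holds (φ ⊓ ψ) v ↔ Holds φ v ∧ Holds ψ v := BoundedFormula.realize_inf
@[simp] theorem holds_ball (t : Tm n) (φ : Fm (n + 1)) (v : Fin n → ℕ) :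
    Holds (ball t φ) v ↔ ∀ a ≤ val t v, Holds φ (Fin.snoc v a) := by simp [ball]
@[simp] theorem holds_bex (t : Tm n) (φ : Fm (n + 1)) (v : Fin n → ℕ) :
    Holds (bex t φ) v ↔ ∃ a ≤ val t v, Holds φ (Fin.snoc v a) := by simp [bex]

theorem val_under (f : Fin m → Tm n) (v : Fin n → ℕ) (a : ℕ) :
    (fun i => val (under f i) (Fin.snoc v a : Fin (n + 1) → ℕ)) =
      (Fin.snoc (fun i => val (f i) v) a : Fin (m + 1) → ℕ) := by
  funext i
  refine Fin.lastCases ?_ (fun i => ?_) i <;> simp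

theorem holds_subst (φ : Fm m) (f : Fin m → Tm n) (v : Fin n → ℕ) :
    Holds (subst φ f) v ↔ Holds φ fun i => val (f i) v := by
  induction φ using Fm.rec' generalizing n with
  | hf => simp
  | he s t => simp [val_substTm]
  | hl s t => simp [val_substTm]
  | hi φ ψ h1 h2 => simp [h1, h2]
  | ha φ h => simp only [subst_all, holds_all, h, val_under]

end Realize

/-! ### Stability under substitution -/

section Stability

variable {m n : ℕ}

theorem IsBounded.subst {φ : Fm m} (h : IsBounded φ) :
    ∀ {n : ℕ} (f : Fin m → Tm n), IsBounded (subst φ f) := by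
  induction h with
  | falsum => intro n f; rw [subst_falsum]; exact .falsum
  | eq s t => intro n f; rw [subst_eq]; exact .eq _ _
  | le s t => intro n f; rw [subst_le]; exact .le _ _
  | imp _ _ h1 h2 => intro n f; rw [subst_imp]; exact .imp (h1 f) (h2 f)
  | ball t _ h => intro n f; rw [subst_ball]; exact .ball _ (h _)
  | bex t _ h => intro n f; rw [subst_bex]; exact .bex _ (h _)

theorem InClass.subst {Γ : Kind} {k : ℕ} {φ : Fm m} (h : InClass Γ k φ) :
    ∀ {n : ℕ} (f : Fin m → Tm n), InClass Γ k (subst φ f) := by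
  induction h with
  | bounded h => intro n f; exact .bounded (h.subst f)
  | of_dual _ h => intro n f; exact .of_dual (h f)
  | imp _ _ h1 h2 => intro n f; rw [subst_imp]; exact .imp (h1 f) (h2 f)
  | ex _ h => intro n f; rw [subst_ex]; exact .ex (h _)
  | all _ h => intro n f; rw [subst_all]; exact .all (h _)
  | ball t _ h => intro n f; rw [subst_ball]; exact .ball _ (h _)
  | bex t _ h => intro n f; rw [subst_bex]; exact .bex _ (h _)

/-- The theorems with free variables are closed under substitution, also when this changes
the context. -/
theorem Provable.subst {T : L.Theory} {φ : Fm m} (h : Provable T φ) :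
    ∀ {n : ℕ} (f : Fin m → Tm n), Provable T (subst φ f) := by
  induction h with
  | ax σ hσ =>
    intro n f
    rw [subst_subst, Subsingleton.elim (fun i => _) (Fin.elim0 : Fin 0 → Tm n)]
    exact .ax σ hσ
  | imp_intro φ ψ => intro n f; simp only [subst_imp]; exact .imp_intro _ _
  | imp_distrib φ ψ χ => intro n f; simp only [subst_imp]; exact .imp_distrib _ _ _
  | not_not φ => intro n f; simp only [subst_imp, subst_not]; exact .not_not _
  | all_inst φ t =>
    intro n f
    rw [subst_imp, subst_inst, ← inst_subst_under, subst_all]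
    exact .all_inst _ _
  | all_imp φ ψ => intro n f; simp only [subst_imp, subst_all]; exact .all_imp _ _
  | all_intro φ =>
    intro n f
    rw [subst_imp, subst_all, subst_lift_under]
    exact .all_intro _
  | eq_refl t => intro n f; rw [subst_eq]; exact .eq_refl _
  | eq_subst s t φ =>
    intro n f
    simp only [subst_imp, subst_inst, ← inst_subst_under, subst_eq]
    exact .eq_subst _ _ _
  | mp _ _ h1 h2 => intro n f; have := h1 f; rw [subst_imp] at this; exact .mp this (h2 f)
  | gen _ h => intro n f; rw [subst_all]; exact .gen (h _)

end Stability

/-! ### Natural deduction -/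

/-- Derivability of a formula from the axioms `T` and the hypotheses `H`, whose free variables
are treated as constants: there is no generalization over them. -/
inductive Ent (T : L.Theory) {n : ℕ} (H : List (Fm n)) : Fm n → Prop
  | hyp {φ : Fm n} : φ ∈ H → Ent T H φ
  | thm {φ : Fm n} : Provable T φ → Ent T H φ
  | mp {φ ψ : Fm n} : Ent T H (φ.imp ψ) → Ent T H φ → Ent T H ψ

section Deduction

variable {T : L.Theory} {n : ℕ} {H : List (Fm n)}

theorem Ent.mono {H' : List (Fm n)} {φ : Fm n} (h : Ent T H φ) (hH : H ⊆ H') : Ent T H' φ := by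
  induction h with
  | hyp h => exact .hyp (hH h)
  | thm h => exact .thm h
  | mp _ _ h1 h2 => exact .mp h1 h2

theorem Ent.cons {φ : Fm n} (ψ : Fm n) (h : Ent T H φ) : Ent T (ψ :: H) φ :=
  h.mono (List.subset_cons_self _ _)

theorem Ent.head {φ : Fm n} : Ent T (φ :: H) φ := .hyp List.mem_cons_self

theorem Ent.provable {φ : Fm n} (h : Ent T [] φ) : Provable T φ := by
  induction h with
  | hyp h => simp at h
  | thm h => exact h
  | mp _ _ h1 h2 => exact .mp h1 h2

/-- The deduction theorem. -/
theorem Ent.deduct {φ ψ : Fm n} (h : Ent T (ψ :: H) φ) : Ent T H (ψ.imp φ) := by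
  induction h with
  | @hyp φ h =>
    rcases List.mem_cons.1 h with rfl | h
    · exact .thm (.mp (.mp (.imp_distrib φ (φ.imp φ) φ) (.imp_intro _ _)) (.imp_intro _ _))
    · exact .mp (.thm (.imp_intro _ _)) (.hyp h)
  | thm h => exact .thm (.mp (.imp_intro _ _) h)
  | mp _ _ h1 h2 => exact .mp (.mp (.thm (.imp_distrib _ _ _)) h1) h2

theorem Ent.cut {φ ψ : Fm n} (h : Ent T H ψ) (h' : Ent T (ψ :: H) φ) : Ent T H φ :=
  .mp h'.deduct h

theorem Ent.not_elim {φ : Fm n} (h : Ent T H φ.not) (h' : Ent T H φ) : Ent T H .falsum := .mp h h'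

theorem Ent.not_intro {φ : Fm n} (h : Ent T (φ :: H) .falsum) : Ent T H φ.not := h.deduct

theorem Ent.byContra {φ : Fm n} (h : Ent T (φ.not :: H) .falsum) : Ent T H φ :=
  .mp (.thm (.not_not φ)) h.deduct

theorem Ent.exfalso {φ : Fm n} (h : Ent T H .falsum) : Ent T H φ := (h.cons _).byContra

theorem Ent.cases {φ : Fm n} (ψ : Fm n) (h1 : Ent T (ψ :: H) φ) (h2 : Ent T (ψ.not :: H) φ) :
    Ent T H φ := by
  have h : Ent T (φ.not :: H) ψ.not :=
    .not_intro (.not_elim (φ := φ) (.hyp (by simp)) (h1.mono (by simp)))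
  exact .byContra (.not_elim (φ := φ) .head (h.cut (h2.mono (by simp))))

theorem Ent.and_intro {φ ψ : Fm n} (h1 : Ent T H φ) (h2 : Ent T H ψ) : Ent T H (φ ⊓ ψ) :=
  .deduct (φ := .falsum) (ψ := φ.imp ψ.not) (.mp (.mp .head (h1.cons _)) (h2.cons _))

theorem Ent.and_left {φ ψ : Fm n} (h : Ent T H (φ ⊓ ψ)) : Ent T H φ :=
  .byContra (.mp (φ := φ.imp ψ.not) (h.cons _)
    (.deduct (.exfalso (.not_elim (φ := φ) (.hyp (by simp)) .head))))

theorem Ent.and_right {φ ψ : Fm n} (h : Ent T H (φ ⊓ ψ)) : Ent T H ψ :=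
  .byContra (.mp (φ := φ.imp ψ.not) (h.cons _) (.deduct (.hyp (by simp))))

theorem Ent.gen {φ : Fm (n + 1)} (h : Ent T (H.map lift) φ) : Ent T H φ.all := by
  induction H generalizing φ with
  | nil => exact .thm (.gen h.provable)
  | cons ψ H ih =>
    have := ih h.deduct
    exact .mp (.mp (.thm (.all_imp _ _)) (this.cons _)) (.mp (.thm (.all_intro ψ)) .head)

theorem Ent.all_elim {φ : Fm (n + 1)} (h : Ent T H φ.all) (t : Tm n) : Ent T H (inst φ t) :=
  .mp (.thm (.all_inst _ _)) h

theorem Ent.ex_intro {φ : Fm (n + 1)} (t : Tm n) (h : Ent T H (inst φ t)) : Ent T H φ.ex := by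
  refine .not_intro (.not_elim (φ := inst φ t) ?_ (h.cons _))
  simpa using Ent.all_elim (T := T) (H := φ.not.all :: H) .head t

theorem Ent.ex_elim {φ : Fm (n + 1)} {χ : Fm n} (h : Ent T H φ.ex)
    (h' : Ent T (φ :: H.map lift) (lift χ)) : Ent T H χ := by
  refine .byContra (.mp (φ := φ.not.all) (h.cons _) (.gen (.deduct (φ := .falsum) ?_)))
  refine .mp (φ := lift χ) (.hyp ?_) (h'.mono ?_)
  · simp only [List.map_cons, lift_not, List.mem_cons]
    exact Or.inr (Or.inl rfl)
  · intro; simp; tauto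

theorem Ent.ex_not {φ : Fm (n + 1)} (h : Ent T H φ.all.not) : Ent T H φ.not.ex :=
  .not_intro (.not_elim (h.cons _)
    (.mp (.thm (.mp (.all_imp _ _) (.gen (.not_not φ)))) .head))

theorem Ent.lift {φ : Fm n} (h : Ent T H φ) : Ent T (H.map Arith.lift) (Arith.lift φ) := by
  induction h with
  | hyp h => exact .hyp (List.mem_map_of_mem h)
  | thm h => exact .thm (h.subst _)
  | mp _ _ h1 h2 => exact .mp (by simpa using h1) h2

/-! ### Equality -/

theorem Ent.refl (t : Tm n) : Ent T H (eq t t) := .thm (.eq_refl t)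

theorem Ent.rewrite {s t : Tm n} (φ : Fm (n + 1)) (h : Ent T H (eq s t))
    (h' : Ent T H (inst φ s)) : Ent T H (inst φ t) :=
  .mp (.mp (.thm (.eq_subst s t φ)) h) h'

theorem Ent.symm {s t : Tm n} (h : Ent T H (eq s t)) : Ent T H (eq t s) := by
  have := h.rewrite (eq (x (Fin.last n)) (liftTm s)) (by simpa [substTm_id] using Ent.refl s)
  simpa [substTm_id] using this

theorem Ent.trans {s t u : Tm n} (h : Ent T H (eq s t)) (h' : Ent T H (eq t u)) :
    Ent T H (eq s u) := by
  have := h'.rewrite (eq (liftTm s) (x (Fin.last n))) (by simpa [substTm_id] using h)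
  simpa [substTm_id] using this

theorem Ent.congr {s t : Tm n} (u : Tm (n + 1)) (h : Ent T H (eq s t)) :
    Ent T H (eq (substTm u (Fin.snoc x s)) (substTm u (Fin.snoc x t))) := by
  have := h.rewrite (eq (liftTm (substTm u (Fin.snoc x s))) u)
    (by simpa [substTm_id] using Ent.refl _)
  simpa [substTm_id] using this

theorem Ent.succ_congr {s t : Tm n} (h : Ent T H (eq s t)) : Ent T H (eq (succ s) (succ t)) := by
  simpa using h.congr (succ (x (Fin.last n)))

theorem Ent.add_congr {s t s' t' : Tm n} (h : Ent T H (eq s t)) (h' : Ent T H (eq s' t')) :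
    Ent T H (eq (add s s') (add t t')) := by
  have h1 := h.congr (add (x (Fin.last n)) (liftTm s'))
  have h2 := h'.congr (add (liftTm t) (x (Fin.last n)))
  simp [substTm_id] at h1 h2
  exact h1.trans h2

theorem Ent.mul_congr {s t s' t' : Tm n} (h : Ent T H (eq s t)) (h' : Ent T H (eq s' t')) :
    Ent T H (eq (mul s s') (mul t t')) := by
  have h1 := h.congr (mul (x (Fin.last n)) (liftTm s'))
  have h2 := h'.congr (mul (liftTm t) (x (Fin.last n)))
  simp [substTm_id] at h1 h2
  exact h1.trans h2

theorem Ent.le_congr {s t s' t' : Tm n} (h : Ent T H (eq s t)) (h' : Ent T H (eq s' t'))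
    (hl : Ent T H (le s s')) : Ent T H (le t t') := by
  have h1 := h.rewrite (le (x (Fin.last n)) (liftTm s')) (by simpa [substTm_id] using hl)
  have h2 := h'.rewrite (le (liftTm t) (x (Fin.last n))) (by simpa [substTm_id] using h1)
  simpa [substTm_id] using h2

/-- Replacing the last free variable by a term that is provably equal to it. -/
theorem Ent.of_inst {H : List (Fm (n + 1))} {φ : Fm (n + 1)} {t : Tm n}
    (h : Ent T H (eq (x (Fin.last n)) (liftTm t))) (h' : Ent T H (Arith.lift (inst φ t))) :
    Ent T H φ := by
  have := h.symm.rewrite (Arith.subst φ (under fun i => x i.castSucc)) (by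
    rw [inst_subst_under]
    rw [Arith.lift, subst_inst] at h'
    rwa [← liftTm_eq_substTm] at h')
  rwa [inst_last_lift_under] at this

end Deduction

/-! ### Robinson's arithmetic -/

section Robinson

variable {T : L.Theory} {n : ℕ} {H : List (Fm n)}

theorem Ent.axQ (hQ : Extends T Q) {σ : L.Sentence} (hσ : σ ∈ Q) :
    Ent T H (Arith.subst σ Fin.elim0) :=
  .thm ((hQ σ hσ).subst _)

theorem under_one (t : Tm n) : under ![t] = ![liftTm t, x (Fin.last n)] := by
  funext i; fin_cases i <;> simp [under, Fin.snoc]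

theorem under_two (s t : Tm n) : under ![s, t] = ![liftTm s, liftTm t, x (Fin.last n)] := by
  funext i; fin_cases i <;> simp [under, Fin.snoc]

theorem Ent.all_elim_one {φ : Fm 1} (h : Ent T H (Arith.subst φ.all (Fin.elim0 : Fin 0 → Tm n)))
    (t : Tm n) : Ent T H (Arith.subst φ ![t]) := by
  rw [subst_all] at h
  have := h.all_elim t
  rw [inst_subst_under] at this
  convert this using 2
  funext i; fin_cases i; simp [Fin.snoc]

theorem Ent.all_elim_two {φ : Fm 2}
    (h : Ent T H (Arith.subst φ.all.all (Fin.elim0 : Fin 0 → Tm n)))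
    (s t : Tm n) : Ent T H (Arith.subst φ ![s, t]) := by
  have := h.all_elim_one s
  rw [subst_all] at this
  have := this.all_elim t
  rw [inst_subst_under] at this
  convert this using 2
  funext i; fin_cases i <;> simp [Fin.snoc]

theorem Ent.succ_ne_zero (hQ : Extends T Q) (t : Tm n) : Ent T H (eq (succ t) zero).not := by
  simpa using (Ent.axQ (H := H) hQ (.inl rfl)).all_elim_one t

theorem Ent.succ_inj (hQ : Extends T Q) {s t : Tm n} (h : Ent T H (eq (succ s) (succ t))) :
    Ent T H (eq s t) := by
  have := (Ent.axQ (H := H) hQ (.inr (.inl rfl))).all_elim_two s t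
  exact .mp (by simpa using this) h

/-- Case distinction: a term is zero or a successor. -/
theorem Ent.zero_or_succ (hQ : Extends T Q) {χ : Fm n} (t : Tm n)
    (h0 : Ent T (eq t zero :: H) χ)
    (h1 : Ent T (eq (liftTm t) (succ (x (Fin.last n))) :: H.map Arith.lift) (Arith.lift χ)) :
    Ent T H χ := by
  refine .cases (eq t zero) h0 (.ex_elim (φ := eq (liftTm t) (succ (x (Fin.last n)))) ?_
    (h1.mono (by simp)))
  have := (Ent.axQ (H := (eq t zero).not :: H) hQ (.inr (.inr (.inl rfl)))).all_elim_one t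
  exact .mp (by simpa [under_one] using this) .head

theorem Ent.add_zero (hQ : Extends T Q) (t : Tm n) : Ent T H (eq (add t zero) t) := by
  simpa using (Ent.axQ (H := H) hQ (.inr (.inr (.inr (.inl rfl))))).all_elim_one t

theorem Ent.add_succ (hQ : Extends T Q) (s t : Tm n) :
    Ent T H (eq (add s (succ t)) (succ (add s t))) := by
  simpa using (Ent.axQ (H := H) hQ (.inr (.inr (.inr (.inr (.inl rfl)))))).all_elim_two s t

theorem Ent.mul_zero (hQ : Extends T Q) (t : Tm n) : Ent T H (eq (mul t zero) zero) := by
  simpa using (Ent.axQ (H := H) hQ (.inr (.inr (.inr (.inr (.inr (.inl rfl))))))).all_elim_one t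

theorem Ent.mul_succ (hQ : Extends T Q) (s t : Tm n) :
    Ent T H (eq (mul s (succ t)) (add (mul s t) s)) := by
  simpa using
    (Ent.axQ (H := H) hQ (.inr (.inr (.inr (.inr (.inr (.inr (.inl rfl)))))))).all_elim_two s t

theorem Ent.le_iff (hQ : Extends T Q) (s t : Tm n) :
    Ent T H ((le s t).imp (eq (add (x (Fin.last n)) (liftTm s)) (liftTm t)).ex ⊓
      (eq (add (x (Fin.last n)) (liftTm s)) (liftTm t)).ex.imp (le s t)) := by
  simpa [BoundedFormula.iff, under_two] using
    (Ent.axQ (H := H) hQ (.inr (.inr (.inr (.inr (.inr (.inr (.inr rfl)))))))).all_elim_two s t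

theorem Ent.le_intro (hQ : Extends T Q) {s t : Tm n} (u : Tm n) (h : Ent T H (eq (add u s) t)) :
    Ent T H (le s t) :=
  .mp (Ent.le_iff hQ s t).and_right (.ex_intro u (by simpa [substTm_id] using h))

theorem Ent.le_elim (hQ : Extends T Q) {s t : Tm n} {χ : Fm n} (h : Ent T H (le s t))
    (h' : Ent T (eq (add (x (Fin.last n)) (liftTm s)) (liftTm t) :: H.map Arith.lift)
      (Arith.lift χ)) : Ent T H χ :=
  (Ent.mp (Ent.le_iff hQ s t).and_left h).ex_elim h'

theorem Ent.zero_le (hQ : Extends T Q) (t : Tm n) : Ent T H (le zero t) :=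
  .le_intro hQ t (.add_zero hQ t)

theorem Ent.succ_le_succ (hQ : Extends T Q) {s t : Tm n} (h : Ent T H (le s t)) :
    Ent T H (le (succ s) (succ t)) := by
  refine h.le_elim hQ ?_
  simp only [lift_le, liftTm_succ]
  exact .le_intro hQ (x (Fin.last n)) ((Ent.add_succ hQ _ _).trans (Ent.head.succ_congr))

theorem Ent.le_of_succ_le_succ (hQ : Extends T Q) {s t : Tm n}
    (h : Ent T H (le (succ s) (succ t))) : Ent T H (le s t) := by
  refine h.le_elim hQ ?_
  simp only [lift_le, liftTm_succ]
  exact .le_intro hQ (x (Fin.last n)) (.succ_inj hQ ((Ent.add_succ hQ _ _).symm.trans .head))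

theorem Ent.not_succ_le_zero (hQ : Extends T Q) {t : Tm n} (h : Ent T H (le (succ t) zero)) :
    Ent T H .falsum := by
  refine h.le_elim hQ ?_
  simp only [lift_falsum, liftTm_succ, liftTm_zero]
  exact .not_elim (Ent.succ_ne_zero hQ _) ((Ent.add_succ hQ _ _).symm.trans .head)

/-- Case distinction: an element below a numeral is a numeral. -/
theorem Ent.le_numeral_cases (hQ : Extends T Q) (k : ℕ) {n : ℕ} {H : List (Fm n)} {χ : Fm n}
    {t : Tm n} (ht : Ent T H (le t (numeral k)))
    (h : ∀ i ≤ k, Ent T (eq t (numeral i) :: H) χ) : Ent T H χ := by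
  induction k generalizing n with
  | zero =>
    refine .zero_or_succ hQ t (h 0 le_rfl) (.exfalso (.not_succ_le_zero hQ
      (t := x (Fin.last n)) (.le_congr .head (.refl _) ?_)))
    simpa [numeral] using ht.lift.cons _
  | succ k ih =>
    refine .zero_or_succ hQ t (h 0 (Nat.zero_le _)) (ih (t := x (Fin.last n)) ?_ fun i hi => ?_)
    · refine .le_of_succ_le_succ hQ (.le_congr .head (.refl _) ?_)
      simpa [numeral] using ht.lift.cons _
    · have h1 := (h (i + 1) (by omega)).lift
      simp only [List.map_cons, lift_eq, liftTm_numeral] at h1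
      refine .cut ?_ (h1.mono (H' := _ :: _) (List.cons_subset_cons _
        (List.subset_cons_of_subset _ (List.subset_cons_self _ _))))
      exact (Ent.cons _ .head).trans (Ent.head.succ_congr)

/-- Case distinction: every element is comparable with every numeral. -/
theorem Ent.le_numeral_or (hQ : Extends T Q) (k : ℕ) {n : ℕ} {H : List (Fm n)} {χ : Fm n}
    (t : Tm n) (h1 : Ent T (le t (numeral k) :: H) χ) (h2 : Ent T (le (numeral k) t :: H) χ) :
    Ent T H χ := by
  induction k generalizing n with
  | zero => exact .cut (.zero_le hQ t) h2
  | succ k ih =>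
    refine .zero_or_succ hQ t ?_ (ih (x (Fin.last n)) ?_ ?_)
    · exact .cut (.le_congr Ent.head.symm (.refl _) (.zero_le hQ _))
        (h1.mono (List.cons_subset_cons _ (List.subset_cons_self _ _)))
    · have h := h1.lift
      simp only [List.map_cons, lift_le, liftTm_numeral] at h
      refine .cut ?_ (h.mono (H' := _ :: _) (List.cons_subset_cons _
        (List.subset_cons_of_subset _ (List.subset_cons_self _ _))))
      exact .le_congr (Ent.cons _ .head).symm (.refl _) (.succ_le_succ hQ .head)
    · have h := h2.lift
      simp only [List.map_cons, lift_le, liftTm_numeral] at h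
      refine .cut ?_ (h.mono (H' := _ :: _) (List.cons_subset_cons _
        (List.subset_cons_of_subset _ (List.subset_cons_self _ _))))
      exact .le_congr (.refl _) (Ent.cons _ .head).symm (.succ_le_succ hQ .head)

theorem Ent.numeral_add (hQ : Extends T Q) (a b : ℕ) :
    Ent T H (eq (add (numeral a) (numeral b)) (numeral (a + b))) := by
  induction b with
  | zero => exact .add_zero hQ _
  | succ b ih => exact (Ent.add_succ hQ _ _).trans ih.succ_congr

theorem Ent.numeral_mul (hQ : Extends T Q) (a b : ℕ) :
    Ent T H (eq (mul (numeral a) (numeral b)) (numeral (a * b))) := by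
  induction b with
  | zero => exact .mul_zero hQ _
  | succ b ih =>
    exact (Ent.mul_succ hQ _ _).trans ((ih.add_congr (.refl _)).trans (.numeral_add hQ _ _))

theorem Ent.numeral_ne (hQ : Extends T Q) {a b : ℕ} (h : a ≠ b) :
    Ent T H (eq (numeral a) (numeral b)).not := by
  induction a generalizing b with
  | zero =>
    rcases b with _ | b
    · exact absurd rfl h
    · exact .not_intro (.not_elim (Ent.succ_ne_zero hQ _) Ent.head.symm)
  | succ a ih =>
    rcases b with _ | b
    · exact .succ_ne_zero hQ _
    · exact .not_intro (.not_elim ((ih (b := b) (by omega)).cons _) (.succ_inj hQ .head))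

theorem Ent.numeral_le (hQ : Extends T Q) {a b : ℕ} (h : a ≤ b) :
    Ent T H (le (numeral a) (numeral b)) := by
  have := Ent.numeral_add (H := H) hQ (b - a) a
  rw [Nat.sub_add_cancel h] at this
  exact .le_intro hQ _ this

theorem Ent.not_numeral_le (hQ : Extends T Q) {a b : ℕ} (h : ¬ a ≤ b) :
    Ent T H (le (numeral a) (numeral b)).not :=
  .not_intro (.le_numeral_cases hQ b .head fun i hi =>
    .not_elim (Ent.numeral_ne hQ (b := i) (by omega)) .head)

/-- The instance of a formula at numerals, as a sentence. -/
def numInst {m : ℕ} (φ : Fm m) (v : Fin m → ℕ) : Fm 0 := subst φ fun i => numeral (v i)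

theorem snoc_numeral {m : ℕ} (v : Fin m → ℕ) (a : ℕ) :
    (Fin.snoc (fun i => numeral (v i)) (numeral a) : Fin (m + 1) → Tm n) =
      fun i => numeral ((Fin.snoc v a : Fin (m + 1) → ℕ) i) := by
  funext i
  refine Fin.lastCases ?_ (fun i => ?_) i <;> simp

theorem inst_numInst {m : ℕ} (φ : Fm (m + 1)) (v : Fin m → ℕ) (a : ℕ) :
    inst (subst φ (under fun i => numeral (v i))) (numeral a) = numInst φ (Fin.snoc v a) := by
  rw [inst_subst_under, snoc_numeral, numInst]

theorem Ent.eval (hQ : Extends T Q) {m : ℕ} (t : Tm m) (v : Fin m → ℕ) :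
    Ent T H (eq (substTm t fun i => numeral (v i)) (numeral (val t v))) := by
  induction t using Tm.rec' with
  | hx i => exact .refl _
  | h0 => rw [substTm_zero]; exact .refl _
  | hs t h => simpa [numeral] using h.succ_congr
  | ha s t h1 h2 => simpa using (h1.add_congr h2).trans (.numeral_add hQ _ _)
  | hm s t h1 h2 => simpa using (h1.mul_congr h2).trans (.numeral_mul hQ _ _)

theorem Ent.ball_elim {t : Tm n} {φ : Fm (n + 1)} (h : Ent T H (ball t φ)) (s : Tm n)
    (hs : Ent T H (le s t)) : Ent T H (inst φ s) := by
  have h1 := h.all_elim s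
  rw [inst_imp] at h1
  refine .mp h1 ?_
  simpa only [inst_le, substTm_x, Fin.snoc_last, substTm_liftTm_snoc] using hs

theorem Ent.bex_intro {t : Tm n} {φ : Fm (n + 1)} (s : Tm n) (hs : Ent T H (le s t))
    (h : Ent T H (inst φ s)) : Ent T H (bex t φ) := by
  refine .ex_intro s ?_
  rw [inst_inf]
  refine .and_intro ?_ h
  simpa only [inst_le, substTm_x, Fin.snoc_last, substTm_liftTm_snoc] using hs

theorem Provable.ball_intro (hQ : Extends T Q) {φ : Fm (n + 1)} {t : Tm n} {k : ℕ}
    (ht : Ent T [] (eq t (numeral k))) (h : ∀ i ≤ k, Provable T (inst φ (numeral i))) :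
    Provable T (ball t φ) := by
  refine .gen (Ent.deduct (.le_numeral_cases hQ k (t := x (Fin.last n))
    (.le_congr (.refl _) ?_ .head) fun i hi => .of_inst (t := numeral i) ?_ ?_)).provable
  · simpa using ht.lift.cons _
  · simpa using Ent.head
  · exact (Ent.thm (H := []) (h i hi)).lift.mono (by simp)

theorem Provable.not_bex (hQ : Extends T Q) {φ : Fm (n + 1)} {t : Tm n} {k : ℕ}
    (ht : Ent T [] (eq t (numeral k))) (h : ∀ i ≤ k, Provable T (inst φ (numeral i)).not) :
    Provable T (bex t φ).not := by
  refine (Ent.not_intro (H := []) (Ent.ex_elim .head ?_)).provable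
  rw [lift_falsum]
  refine .le_numeral_cases hQ k (.le_congr (.refl _) ?_ (Ent.head.and_left)) fun i hi => ?_
  · simpa using ht.lift.mono (List.nil_subset _)
  · refine .not_elim (φ := φ) (.of_inst (t := numeral i) ?_ ?_)
      (Ent.and_right (.hyp (List.mem_cons_of_mem _ List.mem_cons_self)))
    · rw [liftTm_numeral]; exact .head
    · rw [inst_not]
      exact (Ent.thm (H := []) (h i hi)).lift.mono (List.nil_subset _)

/-- The theory `T` proves the true and refutes the false numerical instances of `φ`. -/
def Decides (T : L.Theory) {m : ℕ} (φ : Fm m) : Prop :=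
  ∀ v : Fin m → ℕ, (Holds φ v → Provable T (numInst φ v)) ∧
    (¬ Holds φ v → Provable T (numInst φ v).not)

/-- Every extension of `Q` decides bounded formulas correctly: the value of a closed term is
provable, and a bounded quantifier amounts to a finite conjunction or disjunction. -/
theorem IsBounded.decides (hQ : Extends T Q) {m : ℕ} {φ : Fm m} (h : IsBounded φ) :
    Decides T φ := by
  induction h with
  | falsum => exact fun v => ⟨fun h => h.elim, fun _ => by
      simpa [numInst] using (Ent.not_intro (T := T) (H := []) .head).provable⟩
  | eq s t =>
    intro v
    have hs := Ent.eval (T := T) (H := []) (n := 0) hQ s v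
    have ht := Ent.eval (T := T) (H := []) (n := 0) hQ t v
    simp only [numInst, subst_eq, holds_eq]
    refine ⟨fun h => ?_, fun h => ?_⟩
    · rw [h] at hs
      exact (hs.trans ht.symm).provable
    · exact (Ent.not_intro (.not_elim (Ent.numeral_ne hQ h)
        ((hs.cons _).symm.trans (Ent.head.trans (ht.cons _))))).provable
  | le s t =>
    intro v
    have hs := Ent.eval (T := T) (H := []) (n := 0) hQ s v
    have ht := Ent.eval (T := T) (H := []) (n := 0) hQ t v
    simp only [numInst, subst_le, holds_le]
    refine ⟨fun h => ?_, fun h => ?_⟩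
    · exact (Ent.le_congr hs.symm ht.symm (.numeral_le hQ h)).provable
    · exact (Ent.not_intro (.not_elim (Ent.not_numeral_le hQ h)
        (.le_congr (hs.cons _) (ht.cons _) .head))).provable
  | @imp _ φ ψ _ _ h1 h2 =>
    intro v
    simp only [numInst, subst_imp, holds_imp]
    refine ⟨fun h => ?_, fun h => ?_⟩
    · by_cases h' : Holds φ v
      · exact (Ent.deduct (.cons _ (.thm (H := []) ((h2 v).1 (h h'))))).provable
      · exact (Ent.deduct (.exfalso
          (.not_elim (.thm (H := _ :: []) ((h1 v).2 h')) .head))).provable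
    · push Not at h
      exact (Ent.not_intro (.not_elim (.thm ((h2 v).2 h.2))
        (.mp .head (.thm (H := _ :: []) ((h1 v).1 h.1))))).provable
  | @ball _ t φ _ ih =>
    intro v
    have ht := Ent.eval (T := T) (H := []) (n := 0) hQ t v
    simp only [numInst, subst_ball, holds_ball]
    refine ⟨fun h => ?_, fun h => ?_⟩
    · refine .ball_intro hQ ht fun i hi => ?_
      rw [inst_numInst]
      exact (ih _).1 (h i hi)
    · push Not at h
      obtain ⟨i, hi, h⟩ := h
      refine (Ent.not_intro (H := []) ?_).provable
      refine .not_elim (φ := numInst φ (Fin.snoc v i)) (.thm ((ih _).2 h)) ?_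
      rw [← inst_numInst]
      exact .ball_elim .head (numeral i)
        (.le_congr (.refl _) (ht.symm.mono (List.nil_subset _)) (.numeral_le hQ hi))
  | bex t _ ih =>
    intro v
    have ht := Ent.eval (T := T) (H := []) (n := 0) hQ t v
    simp only [numInst, subst_bex, holds_bex]
    refine ⟨fun h => ?_, fun h => ?_⟩
    · obtain ⟨i, hi, h⟩ := h
      refine (Ent.bex_intro (H := []) (numeral i)
        (.le_congr (.refl _) ht.symm (.numeral_le hQ hi)) ?_).provable
      rw [inst_numInst]
      exact .thm ((ih _).1 h)
    · exact .not_bex hQ ht fun i hi => by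
        rw [inst_numInst]
        exact (ih _).2 fun h' => h ⟨i, hi, h'⟩

end Robinson

/-! ### Prenex formulas -/

/-- Formulas in prenex form: `k` alternating unbounded quantifiers, the first of which is `∃` for
`Γ = Σ` and `∀` for `Γ = Π`, in front of a bounded formula. -/
inductive Strict : Kind → ℕ → ∀ {n : ℕ}, Fm n → Prop
  | bounded {Γ : Kind} {n : ℕ} {φ : Fm n} : IsBounded φ → Strict Γ 0 φ
  | ex {k n : ℕ} {φ : Fm (n + 1)} : Strict .pi k φ → Strict .sigma (k + 1) φ.ex
  | all {k n : ℕ} {φ : Fm (n + 1)} : Strict .sigma k φ → Strict .pi (k + 1) φ.all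

section Strict

variable {T : L.Theory} {Γ : Kind} {k n : ℕ}

theorem Kind.dual_dual (Γ : Kind) : Γ.dual.dual = Γ := by cases Γ <;> rfl

theorem Strict.inClass {φ : Fm n} (h : Strict Γ k φ) : InClass Γ k φ := by
  induction h with
  | bounded h => exact .bounded h
  | ex _ h => exact .ex (.of_dual h)
  | all _ h => exact .all (.of_dual h)

theorem Strict.inClass_succ {φ : Fm n} (h : Strict Γ k φ) : InClass Γ (k + 1) φ := by
  induction h with
  | bounded h => exact .of_dual (.bounded h)
  | ex _ h => exact .ex (.of_dual h)
  | all _ h => exact .all (.of_dual h)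

theorem Strict.inClass_of_lt {φ : Fm n} (h : Strict Γ k φ) {j : ℕ} (hj : k < j) (Γ' : Kind) :
    InClass Γ' j φ := by
  induction j, hj using Nat.le_induction generalizing Γ' with
  | base =>
    by_cases hΓ : Γ' = Γ
    · exact hΓ ▸ h.inClass_succ
    · have : Γ'.dual = Γ := by cases Γ <;> cases Γ' <;> simp_all [Kind.dual]
      exact .of_dual (this ▸ h.inClass)
  | succ j _ ih => exact .of_dual (ih _)

theorem InClass.falsum : InClass Γ k (.falsum : Fm n) := by
  induction k generalizing Γ with
  | zero => exact .bounded .falsum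
  | succ k ih => exact .of_dual ih

theorem InClass.not {φ : Fm n} (h : InClass Γ k φ) : InClass Γ.dual k φ.not := by
  cases k with
  | zero =>
    cases h with
    | bounded h => exact .bounded (.imp h .falsum)
  | succ k => exact .imp (by rwa [Kind.dual_dual]) .falsum

theorem Strict.inClass_of_le {φ : Fm n} (h : Strict Γ k φ) {j : ℕ} (hj : k ≤ j) :
    InClass Γ j φ := by
  rcases hj.eq_or_lt with rfl | hj
  · exact h.inClass
  · exact h.inClass_of_lt hj _

/-- The complement of a set defined by a prenex formula is defined by a prenex formula of the
dual class. -/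
theorem Strict.compl {φ : Fm n} (h : Strict Γ k φ) :
    ∃ ψ : Fm n, Strict Γ.dual k ψ ∧ ∀ v, Holds ψ v ↔ ¬ Holds φ v := by
  induction h with
  | bounded h => exact ⟨_, .bounded (.imp h .falsum), fun v => Iff.rfl⟩
  | ex _ ih =>
    obtain ⟨ψ, h, hψ⟩ := ih
    exact ⟨ψ.all, .all h, fun v => by simp [hψ]⟩
  | all _ ih =>
    obtain ⟨ψ, h, hψ⟩ := ih
    exact ⟨ψ.ex, .ex h, fun v => by simp [hψ]⟩

theorem NConsistent.consistent {j : ℕ} (h : NConsistent j T) : Consistent T := by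
  cases j with
  | zero => exact h
  | succ j =>
    refine fun h0 => h ⟨.falsum, .falsum, fun m => ?_, ?_⟩
    · exact (Ent.exfalso (H := []) (.thm h0)).provable
    · exact (Ent.exfalso (H := []) (.thm h0)).provable

/-- Consistency of level `j + 1` for `Πⱼ`-formulas in which the parameters are numerals. -/
theorem NConsistent.not_provable_ex {j : ℕ} (h : NConsistent (j + 1) T) {ψ : Fm (n + 1)}
    {v : Fin n → ℕ} (hψ : InClass .pi j ψ)
    (h0 : ∀ a : ℕ, Provable T (numInst ψ (Fin.snoc v a)).not) :
    ¬ Provable T (numInst ψ.ex v) := by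
  intro h1
  refine h ⟨subst ψ (under fun i => numeral (v i)), hψ.subst _, fun a => ?_, ?_⟩
  · rw [inst_numInst]; exact h0 a
  · simpa [numInst] using h1

theorem Provable.numInst_ex {φ : Fm (n + 1)} {v : Fin n → ℕ} (a : ℕ)
    (h : Provable T (numInst φ (Fin.snoc v a))) : Provable T (numInst φ.ex v) := by
  rw [numInst, subst_ex]
  refine (Ent.ex_intro (H := []) (numeral a) ?_).provable
  rw [inst_numInst]
  exact .thm h

theorem Provable.numInst_not_all {φ : Fm (n + 1)} {v : Fin n → ℕ} (a : ℕ)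
    (h : Provable T (numInst φ (Fin.snoc v a)).not) : Provable T (numInst φ.all v).not := by
  rw [numInst, subst_all]
  refine (Ent.not_intro (H := []) ?_).provable
  refine .not_elim (.thm h) ?_
  rw [← inst_numInst]
  exact .all_elim .head _

/-- A `j`-consistent extension of `Q` that decides all `Πⱼ₊₁`-sentences proves the true and refutes
the false instances of all prenex formulas of level at most `j`. -/
theorem Strict.decides {j : ℕ} (hQ : Extends T Q) (hcon : NConsistent j T)
    (hdec : Deciding .pi (j + 1) T) {φ : Fm n} (h : Strict Γ k φ) (hk : k ≤ j) :
    Decides T φ := by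
  induction h with
  | bounded h => exact h.decides hQ
  | @ex k n φ hφ ih =>
    intro v
    refine ⟨fun h => ?_, fun h => ?_⟩
    · obtain ⟨a, ha⟩ := (holds_ex φ v).1 h
      exact .numInst_ex a ((ih (by omega) _).1 ha)
    · rw [holds_ex] at h
      refine (hdec (numInst φ.ex v) ((hφ.ex.inClass_of_lt (by omega) _).subst _)).resolve_left ?_
      obtain ⟨j, rfl⟩ := Nat.exists_eq_add_of_le' (Nat.one_le_of_lt hk)
      exact hcon.not_provable_ex (hφ.inClass_of_le (by omega))
        fun a => (ih (by omega) _).2 fun ha => h ⟨a, ha⟩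
  | @all k n φ hφ ih =>
    intro v
    refine ⟨fun h => ?_, fun h => ?_⟩
    · rw [holds_all] at h
      refine (hdec (numInst φ.all v) ((hφ.all.inClass_of_lt (by omega) _).subst _)).resolve_right
        fun h1 => ?_
      obtain ⟨j, rfl⟩ := Nat.exists_eq_add_of_le' (Nat.one_le_of_lt hk)
      refine hcon.not_provable_ex (ψ := φ.not) (v := v)
        (hφ.inClass_of_le (by omega)).not (fun a => ?_) ?_
      · rw [numInst, subst_not]
        exact (Ent.not_intro (H := []) (.not_elim .head
          (.thm ((ih (by omega) _).1 (h a))))).provable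
      · rw [numInst, subst_all] at h1
        rw [numInst, subst_ex, subst_not]
        exact (Ent.thm (H := []) h1).ex_not.provable
    · rw [holds_all] at h
      push Not at h
      obtain ⟨a, ha⟩ := h
      exact .numInst_not_all a ((ih (by omega) _).2 ha)

end Strict

/-! ### The arithmetical hierarchy over the primitive recursive predicates -/

/-- The `Σₖ`-predicates on a coded type: `k` alternating unbounded number quantifiers, the first of
which is `∃`, in front of a primitive recursive predicate. In particular, at level `0` these are
the primitive recursive predicates, which are more than those defined by a bounded formula. -/
def Sig : ℕ → ∀ {α : Type} [Primcodable α], (α → Prop) → Prop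
  | 0, _, _, P => PrimrecPred P
  | k + 1, α, _, P => ∃ R : α × ℕ → Prop, Sig k R ∧ ∀ a, P a ↔ ∃ z, ¬ R (a, z)

namespace Sig

variable {α β γ : Type} [Primcodable α] [Primcodable β] [Primcodable γ] {k : ℕ}

theorem of_iff {P P' : α → Prop} (h : Sig k P) (h' : ∀ a, P' a ↔ P a) : Sig k P' := by
  rwa [show P' = P from funext fun a => propext (h' a)]

theorem comp {P : β → Prop} (h : Sig k P) {f : α → β} (hf : Primrec f) :
    Sig k fun a => P (f a) := by
  induction k generalizing α β with
  | zero => exact PrimrecPred.comp h hf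
  | succ k ih =>
    obtain ⟨R, hR, h⟩ := h
    exact ⟨fun q => R (f q.1, q.2),
      ih hR ((hf.comp .fst).pair .snd), fun a => h (f a)⟩

/-- The complement of a `Σₖ`-predicate is `Σₖ₊₁`, by a dummy quantifier. -/
theorem dummy {P : α → Prop} (h : Sig k fun a => ¬ P a) : Sig (k + 1) P :=
  ⟨fun q => ¬ P q.1, h.comp .fst, fun a => by simp⟩

theorem of_primrec {P : α → Prop} (h : PrimrecPred P) : Sig k P := by
  induction k generalizing P with
  | zero => exact h
  | succ k ih => exact dummy (ih h.not)

theorem eq [DecidableEq β] {f g : α → β} (hf : Primrec f) (hg : Primrec g) :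
    Sig k fun a => f a = g a :=
  of_primrec (Primrec.eq.comp hf hg)

/-- `Σₖ₊₁` is obtained from the complements of `Σₖ`-predicates by existential quantification over
any coded type. -/
theorem mk [Inhabited β] {P : α → Prop} {R : α × β → Prop} (h : Sig k R)
    (hP : ∀ a, P a ↔ ∃ b, ¬ R (a, b)) : Sig (k + 1) P := by
  refine ⟨fun q => R (q.1, (Encodable.decode (α := β) q.2).getD default),
    h.comp (Primrec.fst.pair
      (Primrec.option_getD.comp (Primrec.decode.comp .snd) (.const default))), fun a => ?_⟩
  rw [hP]
  exact ⟨fun ⟨b, hb⟩ => ⟨Encodable.encode b, by simpa using hb⟩, fun ⟨z, hz⟩ => ⟨_, hz⟩⟩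

theorem ex [Inhabited β] {P : α × β → Prop} (h : Sig (k + 1) P) :
    Sig (k + 1) fun a => ∃ b, P (a, b) := by
  obtain ⟨R, hR, h⟩ := h
  refine mk (β := β × ℕ) (R := fun q => R ((q.1, q.2.1), q.2.2)) (hR.comp
    ((Primrec.fst.pair (Primrec.fst.comp .snd)).pair (Primrec.snd.comp .snd))) fun a => ?_
  simp [h]

theorem and_or {P P' : α → Prop} (h : Sig k P) (h' : Sig k P') :
    (Sig k fun a => P a ∧ P' a) ∧ Sig k fun a => P a ∨ P' a := by
  induction k generalizing α with
  | zero => exact ⟨PrimrecPred.and h h', PrimrecPred.or h h'⟩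
  | succ k ih =>
    obtain ⟨R, hR, h⟩ := h
    obtain ⟨R', hR', h'⟩ := h'
    refine ⟨?_, _, (ih hR hR').1, fun a => ?_⟩
    · refine mk (β := ℕ × ℕ) (ih (hR.comp (Primrec.fst.pair (Primrec.fst.comp .snd)))
        (hR'.comp (Primrec.fst.pair (Primrec.snd.comp .snd)))).2 fun a => ?_
      simp only [h, h', Prod.exists, not_or, exists_and_left, exists_and_right]
    · simp only [h, h', not_and_or, exists_or]

theorem and {P P' : α → Prop} (h : Sig k P) (h' : Sig k P') : Sig k fun a => P a ∧ P' a :=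
  (and_or h h').1

theorem or {P P' : α → Prop} (h : Sig k P) (h' : Sig k P') : Sig k fun a => P a ∨ P' a :=
  (and_or h h').2

/-- Closure under quantification over the members of a list. Witnesses for a universal quantifier
over a list are collected in a list of pairs. -/
theorem all_ex_mem [DecidableEq β] {P : α × β → Prop} (h : Sig k P) {f : α → List β}
    (hf : Primrec f) :
    (Sig k fun a => ∀ b ∈ f a, P (a, b)) ∧ Sig k fun a => ∃ b ∈ f a, P (a, b) := by
  induction k generalizing α β with
  | zero =>
    have h' : PrimrecRel fun (b : β) (a : α) => P (a, b) :=
      PrimrecPred.comp h (Primrec.snd.pair .fst)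
    exact ⟨h'.forall_mem_list.comp hf .id, h'.exists_mem_list.comp hf .id⟩
  | succ k ih =>
    obtain ⟨R, hR, h⟩ := h
    constructor
    · have h1 : Sig k fun q : α × List (β × ℕ) =>
          q.2.map Prod.fst ≠ f q.1 ∨ ∃ p ∈ q.2, R ((q.1, p.1), p.2) :=
        or (of_primrec (Primrec.eq.comp
            (Primrec.list_map .snd (Primrec.fst.comp .snd).to₂) (hf.comp .fst)).not)
          (ih (hR.comp (f := fun r : (α × List (β × ℕ)) × β × ℕ => ((r.1.1, r.2.1), r.2.2))
            (((Primrec.fst.comp .fst).pair (Primrec.fst.comp .snd)).pair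
              (Primrec.snd.comp .snd))) .snd).2
      refine mk h1 fun a => ?_
      simp only [h, not_or, not_exists, not_and, not_not, ne_eq]
      constructor
      · intro h0
        choose! g hg using h0
        refine ⟨(f a).map fun b => (b, g b), ?_, ?_⟩
        · simp [Function.comp_def]
        · intro p hp
          obtain ⟨b, hb, rfl⟩ := List.mem_map.1 hp
          exact hg b hb
      · rintro ⟨ps, h1, h2⟩ b hb
        rw [← h1] at hb
        obtain ⟨p, hp, rfl⟩ := List.mem_map.1 hb
        exact ⟨p.2, h2 p hp⟩
    · refine ⟨_, (ih (α := α × ℕ) (P := fun q => R ((q.1.1, q.2), q.1.2)) (hR.comp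
        (((Primrec.fst.comp .fst).pair .snd).pair (Primrec.snd.comp .fst)))
        (hf.comp .fst)).1, fun a => ?_⟩
      simp only [h, not_forall, exists_prop]
      tauto

theorem all_mem [DecidableEq β] {P : α × β → Prop} (h : Sig k P) {f : α → List β}
    (hf : Primrec f) : Sig k fun a => ∀ b ∈ f a, P (a, b) := (all_ex_mem h hf).1

theorem ex_mem [DecidableEq β] {P : α × β → Prop} (h : Sig k P) {f : α → List β}
    (hf : Primrec f) : Sig k fun a => ∃ b ∈ f a, P (a, b) := (all_ex_mem h hf).2

theorem all_le {P : α × ℕ → Prop} (h : Sig k P) {f : α → ℕ}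
    (hf : Primrec f) : Sig k fun a => ∀ b ≤ f a, P (a, b) :=
  (all_mem h (Primrec.list_range.comp (Primrec.succ.comp hf))).of_iff fun a => by simp

theorem ex_le {P : α × ℕ → Prop} (h : Sig k P) {f : α → ℕ}
    (hf : Primrec f) : Sig k fun a => ∃ b ≤ f a, P (a, b) :=
  (ex_mem h (Primrec.list_range.comp (Primrec.succ.comp hf))).of_iff fun a => by simp

theorem mem [DecidableEq β] {f : α → β} {g : α → List β} (hf : Primrec f) (hg : Primrec g) :
    Sig k fun a => f a ∈ g a :=
  (ex_mem (P := fun q => f q.1 = q.2) (eq (hf.comp .fst) .snd) hg).of_iff fun a => by simp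

end Sig

/-! ### Inductively generated sets -/

section Gen

variable {α : Type}

/-- The set inductively generated by the relation `Step`, where `Step (l, a)` says that `a` can be
obtained from members of the list `l`. -/
inductive Gen (Step : List α × α → Prop) : α → Prop
  | mk (l : List α) (a : α) : (∀ b ∈ l, Gen Step b) → Step (l, a) → Gen Step a

/-- A generation sequence, the last element first. -/
def Seq (Step : List α × α → Prop) : List α → Prop
  | [] => True
  | a :: l => Step (l, a) ∧ Seq Step l

variable {Step : List α × α → Prop}

theorem seq_iff [Inhabited α] (l : List α) :
    Seq Step l ↔ ∀ i ∈ List.range l.length, Step (l.drop (i + 1), l.getD i default) := by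
  induction l with
  | nil => simp [Seq]
  | cons a l ih =>
    rw [Seq, ih]
    simp only [List.mem_range, List.length_cons]
    constructor
    · rintro ⟨h0, h⟩ (_ | i) hi
      · simpa using h0
      · simpa using h i (by omega)
    · intro h
      exact ⟨by simpa using h 0 (by omega), fun i hi => by simpa using h (i + 1) (by omega)⟩

theorem Seq.append (hmono : ∀ l l' a, l ⊆ l' → Step (l, a) → Step (l', a)) {l l' : List α}
    (h : Seq Step l) (h' : Seq Step l') : Seq Step (l ++ l') := by
  induction l with
  | nil => exact h'
  | cons a l ih => exact ⟨hmono _ _ _ (by simp) h.1, ih h.2⟩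

theorem gen_iff (hmono : ∀ l l' a, l ⊆ l' → Step (l, a) → Step (l', a)) (a : α) :
    Gen Step a ↔ ∃ l, Seq Step l ∧ a ∈ l := by
  constructor
  · intro h
    induction h with
    | mk l a _ hs ih =>
      have : ∃ l', Seq Step l' ∧ l ⊆ l' := by
        clear hs
        induction l with
        | nil => exact ⟨[], trivial, by simp⟩
        | cons b l ihl =>
          obtain ⟨l1, h1, hb⟩ := ih b (by simp)
          obtain ⟨l2, h2, hl⟩ := ihl (fun c hc => by simp_all) fun c hc => ih c (by simp [hc])
          refine ⟨l1 ++ l2, h1.append hmono h2, List.cons_subset.2 ⟨by simp [hb], ?_⟩⟩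
          exact List.subset_append_of_subset_right _ hl
      obtain ⟨l', h', hl⟩ := this
      exact ⟨a :: l', ⟨hmono _ _ _ hl hs, h'⟩, by simp⟩
  · rintro ⟨l, h, ha⟩
    induction l generalizing a with
    | nil => simp at ha
    | cons b l ih =>
      rcases List.mem_cons.1 ha with rfl | ha
      · exact .mk l a (fun c hc => ih c h.2 hc) h.1
      · exact ih a h.2 ha

/-- A set inductively generated by a `Σₖ₊₁` step relation is `Σₖ₊₁`. -/
theorem Sig.gen [Primcodable α] [Inhabited α] [DecidableEq α] {k : ℕ} (h : Sig (k + 1) Step)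
    (hmono : ∀ l l' a, l ⊆ l' → Step (l, a) → Step (l', a)) : Sig (k + 1) (Gen Step) := by
  have h1 : Sig (k + 1) fun l : List α =>
      ∀ i ∈ List.range l.length, Step (l.drop (i + 1), l.getD i default) :=
    Sig.all_mem (P := fun q : List α × ℕ => Step (q.1.drop (q.2 + 1), q.1.getD q.2 default))
      (h.comp ((Primrec.list_drop.comp (Primrec.succ.comp .snd) .fst).pair
        ((Primrec.list_getD default).comp .fst .snd))) (Primrec.list_range.comp .list_length)
  refine (Sig.ex (P := fun q : α × List α => _) ((h1.comp .snd).and (Sig.mem .fst .snd))).of_iff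
    fun a => ?_
  rw [gen_iff hmono]
  simp only [seq_iff]

end Gen

/-! ### The predicates defined by formulas -/

section Formulas

theorem primrec_snoc {n : ℕ} :
    Primrec fun q : (Fin n → ℕ) × ℕ => (Fin.snoc q.1 q.2 : Fin (n + 1) → ℕ) := by
  refine Primrec.fin_curry.2 (Primrec₂.swap (Primrec.fin_curry₁.2 fun i => ?_))
  refine Fin.lastCases ?_ (fun i => ?_) i
  · simpa using Primrec.snd
  · simpa using Primrec₂.comp (f := fun (v : Fin n → ℕ) i => v i) Primrec.fin_app .fst (.const i)

theorem primrec_val {n : ℕ} (t : Tm n) : Primrec (val t) := by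
  induction t using Tm.rec' with
  | hx i => exact Primrec.fin_app.comp .id (.const i)
  | h0 => exact .const 0
  | hs t h => exact Primrec.succ.comp h
  | ha s t h1 h2 => exact Primrec.nat_add.comp h1 h2
  | hm s t h1 h2 => exact Primrec.nat_mul.comp h1 h2

theorem IsBounded.primrecPred {n : ℕ} {φ : Fm n} (h : IsBounded φ) : PrimrecPred (Holds φ) := by
  induction h with
  | falsum =>
    exact (PrimrecPred.not (Primrec.eq.comp (.const 0) (.const 0))).of_eq fun v => by simp
  | eq s t => exact Primrec.eq.comp (primrec_val s) (primrec_val t)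
  | le s t => exact Primrec.nat_le.comp (primrec_val s) (primrec_val t)
  | imp _ _ h1 h2 => exact (h1.not.or h2).of_eq fun v => by simp [imp_iff_not_or]
  | ball t _ h =>
    exact (Sig.all_le (k := 0) (h.comp primrec_snoc) (primrec_val t)).of_iff fun v => by simp
  | bex t _ h =>
    exact (Sig.ex_le (k := 0) (h.comp primrec_snoc) (primrec_val t)).of_iff fun v => by simp

/-- `Σₖ`-formulas define `Σₖ`-predicates, and `Πₖ`-formulas complements of `Σₖ`-predicates. -/
theorem InClass.sig {Γ : Kind} {k n : ℕ} {φ : Fm n} (h : InClass Γ k φ) :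
    match Γ with
    | .sigma => Sig k (Holds φ)
    | .pi => Sig k fun v => ¬ Holds φ v := by
  induction h with
  | @bounded Γ _ _ h =>
    cases Γ
    · exact .of_primrec h.primrecPred
    · exact .of_primrec h.primrecPred.not
  | @of_dual Γ _ _ _ _ ih =>
    cases Γ
    · exact .dummy ih
    · exact .dummy (Sig.of_iff ih fun v => by simp)
  | @imp Γ _ _ _ _ _ _ h1 h2 =>
    cases Γ
    · exact (Sig.or h1 h2).of_iff fun v => by simp [imp_iff_not_or]
    · exact (Sig.and h1 h2).of_iff fun v => by simp
  | ex _ h => exact (Sig.ex (h.comp primrec_snoc)).of_iff fun v => by simp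
  | all _ h => exact (Sig.ex (h.comp primrec_snoc)).of_iff fun v => by simp
  | ball t _ h => exact (Sig.all_le (h.comp primrec_snoc) (primrec_val t)).of_iff fun v => by simp
  | bex t _ h =>
    exact (Sig.all_le (h.comp primrec_snoc) (primrec_val t)).of_iff fun v => by simp

end Formulas

/-! ### Arithmetical definitions of the primitive recursive predicates -/

/-- Predicates defined by a bounded formula. -/
def D0 {n : ℕ} (P : (Fin n → ℕ) → Prop) : Prop := ∃ δ : Fm n, IsBounded δ ∧ ∀ v, Holds δ v ↔ P v

/-- Predicates defined by a prenex `Σ₁`-formula. -/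
def S1 {n : ℕ} (P : (Fin n → ℕ) → Prop) : Prop :=
  ∃ R : (Fin (n + 1) → ℕ) → Prop, D0 R ∧ ∀ v, P v ↔ ∃ z, R (Fin.snoc v z)

section Definability

variable {m n : ℕ}

theorem D0.of_iff {P P' : (Fin n → ℕ) → Prop} (h : D0 P) (h' : ∀ v, P' v ↔ P v) : D0 P' := by
  rwa [show P' = P from funext fun v => propext (h' v)]

theorem D0.eq (s t : Tm n) : D0 fun v => val s v = val t v := ⟨_, .eq s t, fun _ => Iff.rfl⟩

theorem D0.le (s t : Tm n) : D0 fun v => val s v ≤ val t v := ⟨_, .le s t, fun _ => Iff.rfl⟩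

theorem D0.not {P : (Fin n → ℕ) → Prop} (h : D0 P) : D0 fun v => ¬ P v := by
  obtain ⟨δ, h, hδ⟩ := h
  exact ⟨δ.not, .imp h .falsum, fun v => by simp [hδ]⟩

theorem D0.imp {P P' : (Fin n → ℕ) → Prop} (h : D0 P) (h' : D0 P') : D0 fun v => P v → P' v := by
  obtain ⟨δ, h, hδ⟩ := h
  obtain ⟨δ', h', hδ'⟩ := h'
  exact ⟨δ.imp δ', .imp h h', fun v => by simp [hδ, hδ']⟩

theorem D0.and {P P' : (Fin n → ℕ) → Prop} (h : D0 P) (h' : D0 P') : D0 fun v => P v ∧ P' v :=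
  (h.imp h'.not).not.of_iff fun v => by simp

theorem D0.or {P P' : (Fin n → ℕ) → Prop} (h : D0 P) (h' : D0 P') : D0 fun v => P v ∨ P' v :=
  (h.not.imp h').of_iff fun _ => or_iff_not_imp_left

theorem D0.ball {P : (Fin (n + 1) → ℕ) → Prop} (t : Tm n) (h : D0 P) :
    D0 fun v => ∀ a ≤ val t v, P (Fin.snoc v a) := by
  obtain ⟨δ, h, hδ⟩ := h
  exact ⟨_, .ball t h, fun v => by simp [hδ]⟩

theorem D0.bex {P : (Fin (n + 1) → ℕ) → Prop} (t : Tm n) (h : D0 P) :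
    D0 fun v => ∃ a ≤ val t v, P (Fin.snoc v a) := by
  obtain ⟨δ, h, hδ⟩ := h
  exact ⟨_, .bex t h, fun v => by simp [hδ]⟩

theorem D0.subst {P : (Fin m → ℕ) → Prop} (h : D0 P) (f : Fin m → Tm n) :
    D0 fun v => P fun i => val (f i) v := by
  obtain ⟨δ, h, hδ⟩ := h
  exact ⟨_, h.subst f, fun v => by rw [holds_subst, hδ]⟩

/-- The last two variables may be interchanged. -/
theorem D0.swap {P : (Fin (n + 2) → ℕ) → Prop} (h : D0 P) :
    ∃ P' : (Fin (n + 2) → ℕ) → Prop, D0 P' ∧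
      ∀ (v : Fin n → ℕ) a b, P' (Fin.snoc (Fin.snoc v a : Fin (n + 1) → ℕ) b) ↔
        P (Fin.snoc (Fin.snoc v b : Fin (n + 1) → ℕ) a) := by
  refine ⟨_, h.subst (Fin.snoc (Fin.snoc (fun i => x i.castSucc.castSucc) (x (Fin.last _)) :
    Fin (n + 1) → Tm (n + 2)) (x (Fin.last n).castSucc)), fun v a b => ?_⟩
  apply iff_of_eq
  congr 1
  funext i
  refine Fin.lastCases ?_ (fun i => Fin.lastCases ?_ (fun i => ?_) i) i <;> simp

theorem S1.of_iff {P P' : (Fin n → ℕ) → Prop} (h : S1 P) (h' : ∀ v, P' v ↔ P v) : S1 P' := by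
  rwa [show P' = P from funext fun v => propext (h' v)]

/-- The matrix of a prenex `Σ₁`-formula may be assumed to be monotone in the variable that is
quantified. -/
theorem S1.mono {P : (Fin n → ℕ) → Prop} (h : S1 P) :
    ∃ R : (Fin (n + 1) → ℕ) → Prop, D0 R ∧ (∀ v, P v ↔ ∃ z, R (Fin.snoc v z)) ∧
      ∀ (v : Fin n → ℕ) z z', z ≤ z' → R (Fin.snoc v z) → R (Fin.snoc v z') := by
  obtain ⟨R, hR, h⟩ := h
  have key : ∀ (v : Fin n → ℕ) z a, (fun i => val ((Fin.snoc (fun i => x i.castSucc.castSucc)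
      (x (Fin.last (n + 1))) : Fin (n + 1) → Tm (n + 2)) i)
      (Fin.snoc (Fin.snoc v z : Fin (n + 1) → ℕ) a : Fin (n + 2) → ℕ)) =
      (Fin.snoc v a : Fin (n + 1) → ℕ) := by
    intro v z a
    funext i
    refine Fin.lastCases ?_ (fun i => ?_) i <;> simp
  refine ⟨_, ((hR.subst (Fin.snoc (fun i => x i.castSucc.castSucc) (x (Fin.last (n + 1))))).bex
    (x (Fin.last n))), fun v => ?_, fun v z z' hz => ?_⟩
  · simp only [h, key, val_x, Fin.snoc_last]
    exact ⟨fun ⟨z, hz⟩ => ⟨z, z, le_rfl, hz⟩, fun ⟨_, z, _, hz⟩ => ⟨z, hz⟩⟩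
  · simp only [key, val_x, Fin.snoc_last]
    exact fun ⟨a, ha, h⟩ => ⟨a, ha.trans hz, h⟩

theorem S1.subst {P : (Fin m → ℕ) → Prop} (h : S1 P) (f : Fin m → Tm n) :
    S1 fun v => P fun i => val (f i) v := by
  obtain ⟨R, hR, h⟩ := h
  exact ⟨_, hR.subst (under f), fun v => by simp only [h, val_under]⟩

theorem S1.of_D0 {P : (Fin n → ℕ) → Prop} (h : D0 P) : S1 P :=
  ⟨_, h.subst fun i => x i.castSucc, fun v => by simp⟩

theorem S1.and {P P' : (Fin n → ℕ) → Prop} (h : S1 P) (h' : S1 P') : S1 fun v => P v ∧ P' v := by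
  obtain ⟨R, hR, h, hm⟩ := h.mono
  obtain ⟨R', hR', h', hm'⟩ := h'.mono
  refine ⟨_, hR.and hR', fun v => ?_⟩
  simp only [h, h']
  constructor
  · rintro ⟨⟨z, hz⟩, w, hw⟩
    exact ⟨max z w, hm _ _ _ (le_max_left _ _) hz, hm' _ _ _ (le_max_right _ _) hw⟩
  · rintro ⟨z, hz, hz'⟩
    exact ⟨⟨z, hz⟩, z, hz'⟩

theorem S1.or {P P' : (Fin n → ℕ) → Prop} (h : S1 P) (h' : S1 P') : S1 fun v => P v ∨ P' v := by
  obtain ⟨R, hR, h⟩ := h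
  obtain ⟨R', hR', h'⟩ := h'
  refine ⟨_, hR.or hR', fun v => ?_⟩
  simp only [h, h', exists_or]

theorem S1.ex {P : (Fin n → ℕ) → ℕ → Prop}
    (h : S1 fun u : Fin (n + 1) → ℕ => P (Fin.init u) (u (Fin.last n))) :
    S1 fun v => ∃ a, P v a := by
  obtain ⟨R, hR, h, hm⟩ := h.mono
  obtain ⟨R', hR', hs⟩ := hR.swap
  refine ⟨_, hR'.bex (x (Fin.last n)), fun v => ?_⟩
  have h1 : ∀ a, P v a ↔ ∃ z, R (Fin.snoc (Fin.snoc v a : Fin (n + 1) → ℕ) z) := fun a => by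
    simpa using h (Fin.snoc v a)
  simp only [h1, hs, val_x, Fin.snoc_last]
  constructor
  · rintro ⟨a, z, hz⟩
    exact ⟨max a z, a, le_max_left _ _, hm _ _ _ (le_max_right _ _) hz⟩
  · rintro ⟨w, a, -, hz⟩
    exact ⟨a, w, hz⟩

/-- Closure of the `Σ₁`-predicates under bounded universal quantification: in the standard model
the witnesses for finitely many elements have a common bound. -/
theorem S1.ball {P : (Fin n → ℕ) → ℕ → Prop} (t : Tm n)
    (h : S1 fun u : Fin (n + 1) → ℕ => P (Fin.init u) (u (Fin.last n))) :
    S1 fun v => ∀ a ≤ val t v, P v a := by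
  obtain ⟨R, hR, h, hm⟩ := h.mono
  obtain ⟨R', hR', hs⟩ := hR.swap
  refine ⟨_, hR'.ball (liftTm t), fun v => ?_⟩
  have h1 : ∀ a, P v a ↔ ∃ z, R (Fin.snoc (Fin.snoc v a : Fin (n + 1) → ℕ) z) := fun a => by
    simpa using h (Fin.snoc v a)
  simp only [h1, hs, val_liftTm]
  constructor
  · intro h0
    choose! g hg using h0
    refine ⟨(Finset.range (val t v + 1)).sup g, fun a ha => hm _ _ _ ?_ (hg a ha)⟩
    exact Finset.le_sup (f := g) (by simp; omega)
  · rintro ⟨w, hw⟩ a ha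
    exact ⟨w, hw a ha⟩

theorem S1.forall_fin {P : Fin m → (Fin n → ℕ) → Prop} (h : ∀ i, S1 (P i)) :
    S1 fun v => ∀ i, P i v := by
  induction m with
  | zero => exact (S1.of_D0 (D0.eq zero zero)).of_iff fun v => by simp
  | succ m ih => exact ((h 0).and (ih fun i => h i.succ)).of_iff fun v => Fin.forall_fin_succ

theorem S1.ex_fin {P : (Fin (n + m) → ℕ) → Prop} (h : S1 P) :
    S1 fun v => ∃ w : Fin m → ℕ, P (Fin.append v w) := by
  induction m with
  | zero =>
    refine (h.subst x).of_iff fun v => ?_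
    have : ∀ w : Fin 0 → ℕ, Fin.append v w = v := fun w => by
      funext i
      exact Fin.append_left v w i
    simp [this]
  | succ m ih =>
    refine (ih (P := fun u => ∃ a, P (Fin.snoc u a)) (S1.ex (by simpa using h))).of_iff fun v => ?_
    constructor
    · rintro ⟨w, hw⟩
      refine ⟨Fin.init w, w (Fin.last m), ?_⟩
      rwa [← Fin.append_snoc, Fin.snoc_init_self]
    · rintro ⟨w, a, h⟩
      exact ⟨Fin.snoc w a, by rwa [Fin.append_snoc]⟩

/-- The graph of a function is defined by a prenex `Σ₁`-formula. -/
def S1Graph (f : List.Vector ℕ n → ℕ) : Prop :=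
  S1 fun v : Fin (n + 1) → ℕ => f (List.Vector.ofFn fun i => v i.castSucc) = v (Fin.last n)

theorem S1Graph.app {f : List.Vector ℕ m → ℕ} (h : S1Graph f) (t : Fin m → Tm n) (s : Tm n) :
    S1 fun v => f (List.Vector.ofFn fun i => val (t i) v) = val s v :=
  (S1.subst h (Fin.snoc t s)).of_iff fun v => by simp

theorem S1Graph.comp {f : List.Vector ℕ n → ℕ} {g : Fin n → List.Vector ℕ m → ℕ}
    (hf : S1Graph f) (hg : ∀ i, S1Graph (g i)) :
    S1Graph fun a => f (List.Vector.ofFn fun i => g i a) := by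
  have h1 : S1 fun u : Fin (m + 1 + n) → ℕ =>
      (∀ i, g i (List.Vector.ofFn fun j => val (x (Fin.castAdd n j.castSucc)) u) =
        val (x (Fin.natAdd (m + 1) i)) u) ∧
      f (List.Vector.ofFn fun i => val (x (Fin.natAdd (m + 1) i)) u) =
        val (x (Fin.castAdd n (Fin.last m))) u :=
    (S1.forall_fin fun i => (hg i).app _ _).and (hf.app _ _)
  refine h1.ex_fin.of_iff fun v => ?_
  simp only [val_x, Fin.append_left, Fin.append_right]
  constructor
  · intro h
    exact ⟨_, fun i => rfl, h⟩
  · rintro ⟨w, h1, h2⟩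
    simp only [h1, h2]

/-- The remainder that defines Gödel's beta function is given by a bounded formula. -/
theorem D0.beta (c d i p : Tm n) :
    D0 fun v => val c v % ((val i v + 1) * val d v + 1) = val p v := by
  have h : D0 fun v => (∃ q ≤ val c v, val (add (mul (x (Fin.last n)) (succ (mul (succ (liftTm i))
      (liftTm d)))) (liftTm p)) (Fin.snoc v q : Fin (n + 1) → ℕ) =
        val (liftTm c) (Fin.snoc v q : Fin (n + 1) → ℕ)) ∧
      val p v ≤ val (mul (succ i) d) v :=
    (D0.bex c (D0.eq _ _)).and (D0.le _ _)
  refine h.of_iff fun v => ?_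
  simp only [val_add, val_mul, val_succ, val_x, Fin.snoc_last, val_liftTm]
  generalize (val i v + 1) * val d v = k
  constructor
  · rintro h
    rw [← h]
    exact ⟨⟨val c v / (k + 1), Nat.div_le_self _ _, Nat.div_add_mod' _ _⟩,
      Nat.lt_succ_iff.1 (Nat.mod_lt _ k.succ_pos)⟩
  · rintro ⟨⟨q, -, h⟩, hp⟩
    rw [← h, Nat.mul_add_mod', Nat.mod_eq_of_lt (by omega)]

/-- Primitive recursion is expressed by a code `(c, d)` of the sequence of values for Gödel's beta
function. -/
theorem rec_eq_iff (a : ℕ) (g : ℕ → ℕ → ℕ) (k y : ℕ) :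
    Nat.rec a g k = y ↔ ∃ c d, (∃ p, c % ((0 + 1) * d + 1) = p ∧ a = p) ∧
      (∀ j ≤ k, j = k ∨ ∃ p q, c % ((j + 1) * d + 1) = p ∧
        c % ((j + 1 + 1) * d + 1) = q ∧ g j p = q) ∧ c % ((k + 1) * d + 1) = y := by
  constructor
  · rintro rfl
    set r : ℕ → ℕ := fun j => Nat.rec a g j with hr
    have h : ∀ j ≤ k, (Nat.unbeta ((List.range (k + 1)).map r)).unpair.1 %
        ((j + 1) * (Nat.unbeta ((List.range (k + 1)).map r)).unpair.2 + 1) = r j := fun j hj => by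
      have := Nat.beta_unbeta_coe ((List.range (k + 1)).map r) ⟨j, by simp; omega⟩
      simpa [Nat.beta] using this
    refine ⟨_, _, ⟨_, h 0 (Nat.zero_le _), rfl⟩, fun j hj => ?_, h k le_rfl⟩
    rcases hj.eq_or_lt with hj | hj
    · exact .inl hj
    · exact .inr ⟨_, _, h j hj.le, h (j + 1) hj, rfl⟩
  · rintro ⟨c, d, ⟨_, h0, rfl⟩, hs, rfl⟩
    have : ∀ j ≤ k, Nat.rec a g j = c % ((j + 1) * d + 1) := by
      intro j hj
      induction j with
      | zero => exact h0.symm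
      | succ j ih =>
        obtain h | ⟨p, q, h1, h2, h3⟩ := hs j (by omega)
        · omega
        · rw [h2, ← h3, ← h1, ← ih (by omega)]
    exact this k le_rfl

theorem S1Graph.prec {f : List.Vector ℕ n → ℕ} {g : List.Vector ℕ (n + 2) → ℕ}
    (hf : S1Graph f) (hg : S1Graph g) :
    S1Graph fun v : List.Vector ℕ (n + 1) =>
      v.head.rec (f v.tail) fun y IH => g (y ::ᵥ IH ::ᵥ v.tail) := by
  have h0 : S1 fun u : Fin (n + 4) → ℕ => ∃ p,
      u (Fin.last _).castSucc % ((0 + 1) * u (Fin.last _) + 1) = p ∧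
        f (List.Vector.ofFn fun i => u i.succ.castSucc.castSucc.castSucc) = p :=
    .ex ((S1.of_D0 (D0.beta (x (Fin.last _).castSucc.castSucc) (x (Fin.last _).castSucc) zero
      (x (Fin.last _)))).and (hf.app (fun i => x i.succ.castSucc.castSucc.castSucc.castSucc)
        (x (Fin.last _))))
  have h1 : S1 fun u : Fin (n + 4) → ℕ => ∀ j ≤ u 0, j = u 0 ∨ ∃ p q,
      u (Fin.last _).castSucc % ((j + 1) * u (Fin.last _) + 1) = p ∧
        u (Fin.last _).castSucc % ((j + 1 + 1) * u (Fin.last _) + 1) = q ∧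
        g (j ::ᵥ p ::ᵥ List.Vector.ofFn fun i => u i.succ.castSucc.castSucc.castSucc) = q := by
    refine .ball (x 0) (.or (.of_D0 (.eq (x (Fin.last _)) (x 0))) (.ex (.ex ?_)))
    refine ((S1.of_D0 (D0.beta (x (Fin.last (n + 2)).castSucc.castSucc.castSucc.castSucc)
      (x (Fin.last (n + 3)).castSucc.castSucc.castSucc)
      (x (Fin.last (n + 4)).castSucc.castSucc) (x (Fin.last (n + 5)).castSucc))).and
      ((S1.of_D0 (D0.beta (x (Fin.last (n + 2)).castSucc.castSucc.castSucc.castSucc)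
      (x (Fin.last (n + 3)).castSucc.castSucc.castSucc)
      (succ (x (Fin.last (n + 4)).castSucc.castSucc)) (x (Fin.last (n + 6))))).and
      (hg.app (Fin.cons (x (Fin.last (n + 4)).castSucc.castSucc) (Fin.cons
        (x (Fin.last (n + 5)).castSucc)
        fun i => x i.succ.castSucc.castSucc.castSucc.castSucc.castSucc.castSucc))
        (x (Fin.last (n + 6)))))).of_iff fun u => ?_
    refine and_congr Iff.rfl (and_congr Iff.rfl (iff_of_eq ?_))
    congr 2
  have h2 : S1 fun u : Fin (n + 4) → ℕ =>
      u (Fin.last _).castSucc % ((u 0 + 1) * u (Fin.last _) + 1) =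
        u (Fin.last _).castSucc.castSucc :=
    .of_D0 (D0.beta (x (Fin.last _).castSucc) (x (Fin.last _)) (x 0)
      (x (Fin.last _).castSucc.castSucc))
  have h3 : S1 fun v : Fin (n + 2) → ℕ => ∃ c, ∃ d, (∃ p, c % ((0 + 1) * d + 1) = p ∧
        f (List.Vector.ofFn fun i => v i.succ.castSucc) = p) ∧
      (∀ j ≤ v 0, j = v 0 ∨ ∃ p q, c % ((j + 1) * d + 1) = p ∧ c % ((j + 1 + 1) * d + 1) = q ∧
        g (j ::ᵥ p ::ᵥ List.Vector.ofFn fun i => v i.succ.castSucc) = q) ∧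
      c % ((v 0 + 1) * d + 1) = v (Fin.last _) :=
    .ex (.ex (h0.and (h1.and h2)))
  exact h3.of_iff fun v => rec_eq_iff _ _ _ _

theorem _root_.Nat.Primrec'.s1Graph {f : List.Vector ℕ n → ℕ} (h : Nat.Primrec' f) :
    S1Graph f := by
  induction h with
  | zero => exact S1.of_D0 (D0.eq zero (x 0))
  | succ => exact (S1.of_D0 (D0.eq (succ (x 0)) (x 1))).of_iff fun v => by simp
  | get i => exact (S1.of_D0 (D0.eq (x i.castSucc) (x (Fin.last _)))).of_iff fun v => by simp
  | comp g _ _ hf hg => exact hf.comp hg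
  | prec _ _ hf hg => exact hf.prec hg

theorem primrec_init : Primrec fun u : Fin (n + 1) → ℕ => (Fin.init u, u (Fin.last n)) := by
  have h : ∀ i : Fin (n + 1), Primrec fun u : Fin (n + 1) → ℕ => u i := fun i =>
    Primrec.fin_app.comp .id (.const i)
  exact (Primrec.fin_curry.2 (Primrec₂.swap (Primrec.fin_curry₁.2 fun i => h i.castSucc))).pair
    (h (Fin.last n))

theorem S1.of_primrec {P : (Fin n → ℕ) → Prop} (h : PrimrecPred P) : S1 P := by
  classical
  have h1 : Primrec fun w : List.Vector ℕ n => if P w.get then 1 else 0 :=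
    .ite (h.comp .vector_get') (.const 1) (.const 0)
  refine ((Nat.Primrec'.prim_iff.2 h1).s1Graph.app x (numeral 1)).of_iff fun v => ?_
  have : (List.Vector.ofFn fun i => val (x i) v).get = v := by
    funext i; simp
  rw [this]
  simp

/-- A `Σₖ`-predicate, `k ≥ 1`, is defined in the standard model by a prenex `Σₖ`-formula. -/
theorem Sig.exists_strict {k : ℕ} {P : (Fin n → ℕ) → Prop} (h : Sig (k + 1) P) :
    ∃ φ : Fm n, Strict .sigma (k + 1) φ ∧ ∀ v, Holds φ v ↔ P v := by
  induction k generalizing n with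
  | zero =>
    obtain ⟨R, hR, h⟩ := h
    have h1 : S1 P := (S1.ex (P := fun v z => ¬ R (v, z))
      (.of_primrec ((PrimrecPred.not (p := R) hR).comp primrec_init))).of_iff h
    obtain ⟨R', ⟨δ, hδ, h2⟩, h3⟩ := h1
    exact ⟨δ.ex, .ex (.bounded hδ), fun v => by simp [h2, h3]⟩
  | succ k ih =>
    obtain ⟨R, hR, h⟩ := h
    obtain ⟨φ, hφ, h1⟩ := ih (hR.comp primrec_init)
    obtain ⟨ψ, hψ, h2⟩ := hφ.compl
    exact ⟨ψ.ex, .ex hψ, fun v => by simp [h, h2, h1]⟩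

/-- A `Σₖ₊₁`-predicate is the projection of a relation defined by a prenex `Πₖ`-formula. -/
theorem Sig.exists_strict_pi {k : ℕ} {P : (Fin n → ℕ) → Prop} (h : Sig (k + 1) P) :
    ∃ φ : Fm (n + 1), Strict .pi k φ ∧ ∀ v, P v ↔ ∃ z, Holds φ (Fin.snoc v z) := by
  obtain ⟨φ, hφ, h⟩ := h.exists_strict
  cases hφ with
  | ex hφ => exact ⟨_, hφ, fun v => by simp [← h]⟩

end Definability

/-! ### Gödel numbers -/

section Codes

variable {m n : ℕ}

@[simp] theorem codeTm_x (i : Fin n) : codeTm (x i) = Nat.pair 0 i := by rw [x, codeTm]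
@[simp] theorem codeTm_zero : codeTm (zero : Tm n) = Nat.pair 1 0 := by rw [zero, codeTm]
@[simp] theorem codeTm_succ (t : Tm n) : codeTm (succ t) = Nat.pair 2 (codeTm t) := by
  rw [succ, codeTm]; rfl
@[simp] theorem codeTm_add (s t : Tm n) :
    codeTm (add s t) = Nat.pair 3 (Nat.pair (codeTm s) (codeTm t)) := by
  rw [add, codeTm]; rfl
@[simp] theorem codeTm_mul (s t : Tm n) :
    codeTm (mul s t) = Nat.pair 4 (Nat.pair (codeTm s) (codeTm t)) := by
  rw [mul, codeTm]; rfl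
@[simp] theorem code_falsum : code (.falsum : Fm n) = Nat.pair 0 0 := by rw [code]
@[simp] theorem code_eq (s t : Tm n) :
    code (eq s t) = Nat.pair 1 (Nat.pair (codeTm s) (codeTm t)) := by
  rw [eq, code]
@[simp] theorem code_le (s t : Tm n) :
    code (le s t) = Nat.pair 2 (Nat.pair (codeTm s) (codeTm t)) := by
  rw [le, code]; rfl
@[simp] theorem code_imp (φ ψ : Fm n) :
    code (φ.imp ψ) = Nat.pair 3 (Nat.pair (code φ) (code ψ)) := by
  rw [code]
@[simp] theorem code_all (φ : Fm (n + 1)) : code φ.all = Nat.pair 4 (code φ) := by rw [code]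
@[simp] theorem code_not (φ : Fm n) :
    code φ.not = Nat.pair 3 (Nat.pair (code φ) (Nat.pair 0 0)) :=
  (code_imp φ .falsum).trans (by simp)

theorem codeTm_liftTm (t : Tm n) : codeTm (liftTm t) = codeTm t := by
  induction t using Tm.rec' <;> simp_all

theorem codeTm_inj {s t : Tm n} (h : codeTm s = codeTm t) : s = t := by
  induction s using Tm.rec' generalizing t with
  | hx i => induction t using Tm.rec' <;> simp_all [← Fin.ext_iff]
  | h0 => induction t using Tm.rec' <;> simp_all
  | hs s ih =>
    induction t using Tm.rec' <;> simp only [codeTm_x, codeTm_zero, codeTm_succ, codeTm_add,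
      codeTm_mul, Nat.pair_eq_pair] at h <;> first | omega | skip
    rw [ih h.2]
  | ha s s' ih ih' =>
    induction t using Tm.rec' <;> simp only [codeTm_x, codeTm_zero, codeTm_succ, codeTm_add,
      codeTm_mul, Nat.pair_eq_pair] at h <;> first | omega | skip
    rw [ih h.2.1, ih' h.2.2]
  | hm s s' ih ih' =>
    induction t using Tm.rec' <;> simp only [codeTm_x, codeTm_zero, codeTm_succ, codeTm_add,
      codeTm_mul, Nat.pair_eq_pair] at h <;> first | omega | skip
    rw [ih h.2.1, ih' h.2.2]

theorem exists_imp_of_code {φ : Fm n} {a b : ℕ} (h : code φ = Nat.pair 3 (Nat.pair a b)) :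
    ∃ φ₁ φ₂ : Fm n, φ = φ₁.imp φ₂ ∧ code φ₁ = a ∧ code φ₂ = b := by
  induction φ using Fm.rec' <;> simp only [code_falsum, code_eq, code_le, code_imp, code_all,
    Nat.pair_eq_pair] at h <;> first | omega | skip
  exact ⟨_, _, rfl, h.2⟩

theorem code_inj {φ ψ : Fm n} (h : code φ = code ψ) : φ = ψ := by
  induction φ using Fm.rec' with
  | hf =>
    induction ψ using Fm.rec' <;> simp_all
  | he s t =>
    induction ψ using Fm.rec' <;> simp only [code_falsum, code_eq, code_le, code_imp, code_all,
      Nat.pair_eq_pair] at h <;> first | omega | skip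
    rw [codeTm_inj h.2.1, codeTm_inj h.2.2]
  | hl s t =>
    induction ψ using Fm.rec' <;> simp only [code_falsum, code_eq, code_le, code_imp, code_all,
      Nat.pair_eq_pair] at h <;> first | omega | skip
    rw [codeTm_inj h.2.1, codeTm_inj h.2.2]
  | hi φ φ' ih ih' =>
    rw [code_imp] at h
    obtain ⟨ψ, ψ', rfl, h1, h2⟩ := exists_imp_of_code h.symm
    rw [ih h1.symm, ih' h2.symm]
  | ha φ ih =>
    induction ψ using Fm.rec' <;> simp only [code_falsum, code_eq, code_le, code_imp, code_all,
      Nat.pair_eq_pair] at h <;> first | omega | skip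
    rw [ih h.2]

end Codes

/-! ### Arithmetization of substitution -/

attribute [fun_prop] Primrec
attribute [fun_prop] Primrec.id Primrec.const Primrec.fst Primrec.snd Primrec.comp Primrec.pair

@[fun_prop] theorem primrec_natPair {α : Type} [Primcodable α] {f g : α → ℕ} (hf : Primrec f)
    (hg : Primrec g) : Primrec fun a => Nat.pair (f a) (g a) := Primrec₂.natPair.comp hf hg

@[fun_prop] theorem primrec_add {α : Type} [Primcodable α] {f g : α → ℕ} (hf : Primrec f)
    (hg : Primrec g) : Primrec fun a => f a + g a := Primrec.nat_add.comp hf hg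

@[fun_prop] theorem primrec_sub {α : Type} [Primcodable α] {f g : α → ℕ} (hf : Primrec f)
    (hg : Primrec g) : Primrec fun a => f a - g a := Primrec.nat_sub.comp hf hg

namespace Sig

variable {α β : Type} [Primcodable α] [Primcodable β] [Inhabited β] {k : ℕ}

/-- Closure under existential quantification, for curried predicates. -/
theorem exists' {P : α → β → Prop} (h : Sig (k + 1) fun q : α × β => P q.1 q.2) :
    Sig (k + 1) fun a => ∃ b, P a b := ex (P := fun q => P q.1 q.2) h

theorem lt {f g : α → ℕ} (hf : Primrec f) (hg : Primrec g) : Sig k fun a => f a < g a :=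
  of_primrec (Primrec.nat_lt.comp hf hg)

end Sig

section Substitution

variable {m n : ℕ}

/-- The code of the term that arises from `t` if each variable `xᵢ` is replaced by the term
with code `V i`. -/
def substCodeTm (V : ℕ → ℕ) (t : Tm n) : ℕ :=
  match t with
  | .var (.inl e) => e.elim
  | .var (.inr i) => V i
  | .func .zero _ => Nat.pair 1 0
  | .func .succ ts => Nat.pair 2 (substCodeTm V (ts 0))
  | .func .add ts => Nat.pair 3 (Nat.pair (substCodeTm V (ts 0)) (substCodeTm V (ts 1)))
  | .func .mul ts => Nat.pair 4 (Nat.pair (substCodeTm V (ts 0)) (substCodeTm V (ts 1)))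

/-- The code of the formula that arises from `φ` if each variable `xᵢ`, free or bound, is replaced
by the term with code `V i`. -/
def substCode (V : ℕ → ℕ) : ∀ {n : ℕ}, Fm n → ℕ
  | _, .falsum => Nat.pair 0 0
  | _, .equal s t => Nat.pair 1 (Nat.pair (substCodeTm V s) (substCodeTm V t))
  | _, .rel .le ts => Nat.pair 2 (Nat.pair (substCodeTm V (ts 0)) (substCodeTm V (ts 1)))
  | _, .imp φ ψ => Nat.pair 3 (Nat.pair (substCode V φ) (substCode V ψ))
  | _, .all φ => Nat.pair 4 (substCode V φ)

variable {V : ℕ → ℕ}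

@[simp] theorem substCodeTm_x (i : Fin n) : substCodeTm V (x i) = V i := by rw [x, substCodeTm]
@[simp] theorem substCodeTm_zero : substCodeTm V (zero : Tm n) = Nat.pair 1 0 := by
  rw [zero, substCodeTm]
@[simp] theorem substCodeTm_succ (t : Tm n) :
    substCodeTm V (succ t) = Nat.pair 2 (substCodeTm V t) := by
  rw [succ, substCodeTm]; rfl
@[simp] theorem substCodeTm_add (s t : Tm n) :
    substCodeTm V (add s t) = Nat.pair 3 (Nat.pair (substCodeTm V s) (substCodeTm V t)) := by
  rw [add, substCodeTm]; rfl
@[simp] theorem substCodeTm_mul (s t : Tm n) :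
    substCodeTm V (mul s t) = Nat.pair 4 (Nat.pair (substCodeTm V s) (substCodeTm V t)) := by
  rw [mul, substCodeTm]; rfl
@[simp] theorem substCode_falsum : substCode V (.falsum : Fm n) = Nat.pair 0 0 := by rw [substCode]
@[simp] theorem substCode_eq (s t : Tm n) :
    substCode V (eq s t) = Nat.pair 1 (Nat.pair (substCodeTm V s) (substCodeTm V t)) := by
  rw [eq, substCode]
@[simp] theorem substCode_le (s t : Tm n) :
    substCode V (le s t) = Nat.pair 2 (Nat.pair (substCodeTm V s) (substCodeTm V t)) := by
  rw [le, substCode]; rfl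
@[simp] theorem substCode_imp (φ ψ : Fm n) :
    substCode V (φ.imp ψ) = Nat.pair 3 (Nat.pair (substCode V φ) (substCode V ψ)) := by
  rw [substCode]
@[simp] theorem substCode_all (φ : Fm (n + 1)) :
    substCode V φ.all = Nat.pair 4 (substCode V φ) := by rw [substCode]

theorem codeTm_substTm {f : Fin m → Tm n} (hV : ∀ i, codeTm (f i) = V i) (t : Tm m) :
    codeTm (substTm t f) = substCodeTm V t := by
  induction t using Tm.rec' <;> simp_all

/-- The code of a substitution instance. As variables are numbered from the outermost quantifier
inwards, substitution under a quantifier acts on the codes of variables in the same way. -/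
theorem code_subst {f : Fin m → Tm n} (hV : ∀ i, codeTm (f i) = V i)
    (hV' : ∀ j, V (m + j) = Nat.pair 0 (n + j)) (φ : Fm m) :
    code (subst φ f) = substCode V φ := by
  induction φ using Fm.rec' generalizing n with
  | hf => simp
  | he s t => simp [codeTm_substTm hV]
  | hl s t => simp [codeTm_substTm hV]
  | hi φ ψ h1 h2 => simp [h1 hV hV', h2 hV hV']
  | @ha m φ h =>
    rw [subst_all, code_all, substCode_all, h (f := under f)]
    · intro i
      refine Fin.lastCases ?_ (fun i => ?_) i
      · simpa using (hV' 0).symm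
      · simpa [codeTm_liftTm] using hV i
    · intro j
      simpa [Nat.add_assoc, Nat.add_comm 1] using hV' (j + 1)

/-- Maps from variables to codes of terms, coded by triples `(k, s, t)`: the variable `xᵢ` is kept if
`i < k`; for `s = 0`, the variable `xₖ` is replaced by the term with code `t`; the index of any
other variable is changed by `s - 1`. Instances at a term (`s = 0`), weakening (`s = 2`), and the
passage from sentences to formulas in `n` variables (`k = 0`, `s = n + 1`) are of this form. -/
def varMap (e : ℕ × ℕ × ℕ) (i : ℕ) : ℕ :=
  if i < e.1 then Nat.pair 0 i else
    if i = e.1 ∧ e.2.1 = 0 then e.2.2 else Nat.pair 0 (i + e.2.1 - 1)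

theorem code_inst (φ : Fm (n + 1)) (t : Tm n) :
    code (inst φ t) = substCode (varMap (n, 0, codeTm t)) φ := by
  refine code_subst (fun i => ?_) (fun j => ?_) φ
  · refine Fin.lastCases ?_ (fun i => ?_) i <;> simp [varMap]
  · simp [varMap, show ¬ n + 1 + j < n by omega, show ¬ n + 1 + j = n by omega,
      show n + 1 + j - 1 = n + j by omega]

theorem code_lift (φ : Fm n) : code (lift φ) = substCode (varMap (n, 2, 0)) φ := by
  refine code_subst (fun i => ?_) (fun j => ?_) φ
  · simp [varMap]
  · simp [varMap, show n + j + 1 = n + 1 + j by omega]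

theorem code_subst_elim0 (φ : Fm 0) :
    code (subst φ Fin.elim0 : Fm n) = substCode (varMap (0, n + 1, 0)) φ := by
  refine code_subst (fun i => i.elim0) (fun j => ?_) φ
  simp [varMap, Nat.add_comm]

theorem substCodeTm_id (t : Tm n) : substCodeTm (varMap (0, 1, 0)) t = codeTm t := by
  rw [← codeTm_substTm (f := x) (fun i => by simp [varMap]), substTm_id]

theorem substCode_id (φ : Fm n) : substCode (varMap (0, 1, 0)) φ = code φ := by
  rw [← code_subst (f := x) (fun i => by simp [varMap]) (fun j => by simp [varMap]), subst_id]

@[fun_prop] theorem primrec_varMap {α : Type} [Primcodable α] {e : α → ℕ × ℕ × ℕ} {i : α → ℕ}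
    (he : Primrec e) (hi : Primrec i) : Primrec fun a => varMap (e a) (i a) := by
  unfold varMap
  refine .ite (Primrec.nat_lt.comp hi (by fun_prop)) (by fun_prop) (.ite (.and
    (Primrec.eq.comp hi (by fun_prop)) (Primrec.eq.comp (by fun_prop) (.const 0)))
    (by fun_prop) (by fun_prop))

/-- The steps that generate the quadruples `(e, n, c, d)` where `c` is the code of a term in `n`
variables and `d` is the code of its image under the map of variables `e`. -/
def TmStep (q : List ((ℕ × ℕ × ℕ) × ℕ × ℕ × ℕ) × (ℕ × ℕ × ℕ) × ℕ × ℕ × ℕ) : Prop :=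
  (∃ i, i < q.2.2.1 ∧ q.2.2.2.1 = Nat.pair 0 i ∧ q.2.2.2.2 = varMap q.2.1 i) ∨
  (q.2.2.2.1 = Nat.pair 1 0 ∧ q.2.2.2.2 = Nat.pair 1 0) ∨
  (∃ c d, (q.2.1, q.2.2.1, c, d) ∈ q.1 ∧
    q.2.2.2.1 = Nat.pair 2 c ∧ q.2.2.2.2 = Nat.pair 2 d) ∨
  ∃ k c d c' d', (k = 3 ∨ k = 4) ∧ (q.2.1, q.2.2.1, c, d) ∈ q.1 ∧ (q.2.1, q.2.2.1, c', d') ∈ q.1 ∧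
    q.2.2.2.1 = Nat.pair k (Nat.pair c c') ∧ q.2.2.2.2 = Nat.pair k (Nat.pair d d')

/-- The steps that generate the quadruples `(e, n, c, d)` where `c` is the code of a formula in `n`
free variables and `d` is the code of its image under the map of variables `e`. -/
def FmStep (q : List ((ℕ × ℕ × ℕ) × ℕ × ℕ × ℕ) × (ℕ × ℕ × ℕ) × ℕ × ℕ × ℕ) : Prop :=
  (q.2.2.2.1 = Nat.pair 0 0 ∧ q.2.2.2.2 = Nat.pair 0 0) ∨
  (∃ k c d c' d', (k = 1 ∨ k = 2) ∧ Gen TmStep (q.2.1, q.2.2.1, c, d) ∧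
    Gen TmStep (q.2.1, q.2.2.1, c', d') ∧
    q.2.2.2.1 = Nat.pair k (Nat.pair c c') ∧ q.2.2.2.2 = Nat.pair k (Nat.pair d d')) ∨
  (∃ c d c' d', (q.2.1, q.2.2.1, c, d) ∈ q.1 ∧ (q.2.1, q.2.2.1, c', d') ∈ q.1 ∧
    q.2.2.2.1 = Nat.pair 3 (Nat.pair c c') ∧ q.2.2.2.2 = Nat.pair 3 (Nat.pair d d')) ∨
  ∃ c d, (q.2.1, q.2.2.1 + 1, c, d) ∈ q.1 ∧
    q.2.2.2.1 = Nat.pair 4 c ∧ q.2.2.2.2 = Nat.pair 4 d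

theorem sig_tmStep {k : ℕ} : Sig (k + 1) TmStep := by
  unfold TmStep
  -- the closure properties of `Σₖ₊₁` follow the logical structure of the definition
  repeat' first
    | apply Sig.or | apply Sig.exists' | apply Sig.and | apply Sig.mem | apply Sig.eq | apply Sig.lt
  all_goals fun_prop

theorem TmStep.mono (l l' : List ((ℕ × ℕ × ℕ) × ℕ × ℕ × ℕ)) (a) (h : l ⊆ l')
    (hs : TmStep (l, a)) : TmStep (l', a) := by
  rcases hs with hs | hs | ⟨c, d, h1, hs⟩ | ⟨k, c, d, c', d', h0, h1, h2, hs⟩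
  · exact .inl hs
  · exact .inr (.inl hs)
  · exact .inr (.inr (.inl ⟨c, d, h h1, hs⟩))
  · exact .inr (.inr (.inr ⟨k, c, d, c', d', h0, h h1, h h2, hs⟩))

theorem gen_tmStep_iff {e : ℕ × ℕ × ℕ} {n c d : ℕ} :
    Gen TmStep (e, n, c, d) ↔ ∃ t : Tm n, codeTm t = c ∧ substCodeTm (varMap e) t = d := by
  constructor
  · intro h
    generalize hq : (e, n, c, d) = q at h
    induction h generalizing e n c d with
    | mk l q _ hs ih =>
      subst hq
      rcases hs with ⟨i, hi, h1, h2⟩ | ⟨h1, h2⟩ | ⟨c₁, d₁, hl, h1, h2⟩ |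
        ⟨k, c₁, d₁, c₂, d₂, hk, hl, hl', h1, h2⟩ <;> dsimp only at * <;> subst h1 h2
      · exact ⟨x ⟨i, hi⟩, by simp⟩
      · exact ⟨zero, by simp⟩
      · obtain ⟨t, rfl, rfl⟩ := ih _ hl rfl
        exact ⟨succ t, by simp⟩
      · obtain ⟨s, rfl, rfl⟩ := ih _ hl rfl
        obtain ⟨t, rfl, rfl⟩ := ih _ hl' rfl
        rcases hk with rfl | rfl
        · exact ⟨add s t, by simp⟩
        · exact ⟨mul s t, by simp⟩
  · rintro ⟨t, rfl, rfl⟩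
    induction t using Tm.rec' with
    | hx i => exact .mk [] _ (by simp) (.inl ⟨i, by simp⟩)
    | h0 => exact .mk [] _ (by simp) (.inr (.inl (by simp)))
    | hs t h =>
      exact .mk [_] _ (by simpa using h) (.inr (.inr (.inl ⟨_, _, List.mem_singleton_self _,
        by simp⟩)))
    | ha s t h h' =>
      exact .mk [_, _] _ (by simpa using ⟨h, h'⟩) (.inr (.inr (.inr ⟨3, _, _, _, _, .inl rfl,
        List.mem_cons_self, List.mem_cons_of_mem _ List.mem_cons_self, by simp⟩)))
    | hm s t h h' =>
      exact .mk [_, _] _ (by simpa using ⟨h, h'⟩) (.inr (.inr (.inr ⟨4, _, _, _, _, .inr rfl,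
        List.mem_cons_self, List.mem_cons_of_mem _ List.mem_cons_self, by simp⟩)))

theorem sig_gen_tmStep {k : ℕ} : Sig (k + 1) (Gen TmStep) := sig_tmStep.gen TmStep.mono

theorem sig_fmStep {k : ℕ} : Sig (k + 1) FmStep := by
  unfold FmStep
  repeat' first
    | apply Sig.or | apply Sig.exists' | apply Sig.and | apply Sig.mem | apply Sig.eq
    | apply sig_gen_tmStep.comp
  all_goals fun_prop

theorem FmStep.mono (l l' : List ((ℕ × ℕ × ℕ) × ℕ × ℕ × ℕ)) (a) (h : l ⊆ l')
    (hs : FmStep (l, a)) : FmStep (l', a) := by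
  rcases hs with hs | hs | ⟨c, d, c', d', h1, h2, hs⟩ | ⟨c, d, h1, hs⟩
  · exact .inl hs
  · exact .inr (.inl hs)
  · exact .inr (.inr (.inl ⟨c, d, c', d', h h1, h h2, hs⟩))
  · exact .inr (.inr (.inr ⟨c, d, h h1, hs⟩))

theorem gen_fmStep_iff {e : ℕ × ℕ × ℕ} {n c d : ℕ} :
    Gen FmStep (e, n, c, d) ↔ ∃ φ : Fm n, code φ = c ∧ substCode (varMap e) φ = d := by
  constructor
  · intro h
    generalize hq : (e, n, c, d) = q at h
    induction h generalizing e n c d with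
    | mk l q _ hs ih =>
      subst hq
      rcases hs with ⟨h1, h2⟩ | ⟨k, c₁, d₁, c₂, d₂, hk, hl, hl', h1, h2⟩ |
        ⟨c₁, d₁, c₂, d₂, hl, hl', h1, h2⟩ | ⟨c₁, d₁, hl, h1, h2⟩ <;>
        dsimp only at * <;> subst h1 h2
      · exact ⟨.falsum, by simp⟩
      · obtain ⟨s, rfl, rfl⟩ := gen_tmStep_iff.1 hl
        obtain ⟨t, rfl, rfl⟩ := gen_tmStep_iff.1 hl'
        rcases hk with rfl | rfl
        · exact ⟨eq s t, by simp⟩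
        · exact ⟨le s t, by simp⟩
      · obtain ⟨φ, rfl, rfl⟩ := ih _ hl rfl
        obtain ⟨ψ, rfl, rfl⟩ := ih _ hl' rfl
        exact ⟨φ.imp ψ, by simp⟩
      · obtain ⟨φ, rfl, rfl⟩ := ih _ hl rfl
        exact ⟨φ.all, by simp⟩
  · rintro ⟨φ, rfl, rfl⟩
    induction φ using Fm.rec' with
    | hf => exact .mk [] _ (by simp) (.inl (by simp))
    | he s t =>
      exact .mk [] _ (by simp) (.inr (.inl ⟨1, _, _, _, _, .inl rfl,
        gen_tmStep_iff.2 ⟨s, rfl, rfl⟩, gen_tmStep_iff.2 ⟨t, rfl, rfl⟩, by simp⟩))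
    | hl s t =>
      exact .mk [] _ (by simp) (.inr (.inl ⟨2, _, _, _, _, .inr rfl,
        gen_tmStep_iff.2 ⟨s, rfl, rfl⟩, gen_tmStep_iff.2 ⟨t, rfl, rfl⟩, by simp⟩))
    | hi φ ψ h h' =>
      exact .mk [_, _] _ (by simpa using ⟨h, h'⟩) (.inr (.inr (.inl ⟨_, _, _, _,
        List.mem_cons_self, List.mem_cons_of_mem _ List.mem_cons_self, by simp⟩)))
    | ha φ h =>
      exact .mk [_] _ (by simpa using h) (.inr (.inr (.inr ⟨_, _, List.mem_singleton_self _,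
        by simp⟩)))

theorem sig_gen_fmStep {k : ℕ} : Sig (k + 1) (Gen FmStep) := sig_fmStep.gen FmStep.mono

end Substitution

/-! ### Arithmetization of provability -/

section Provability

/-- `IsTm n c`: the number `c` is the code of a term in `n` variables. -/
def IsTm (n c : ℕ) : Prop := Gen TmStep ((0, 1, 0), n, c, c)

/-- `IsFm n c`: the number `c` is the code of a formula in `n` variables. -/
def IsFm (n c : ℕ) : Prop := Gen FmStep ((0, 1, 0), n, c, c)

theorem isTm_iff {n c : ℕ} : IsTm n c ↔ ∃ t : Tm n, codeTm t = c := by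
  simp [IsTm, gen_tmStep_iff, substCodeTm_id]

theorem isFm_iff {n c : ℕ} : IsFm n c ↔ ∃ φ : Fm n, code φ = c := by
  simp [IsFm, gen_fmStep_iff, substCode_id]

/-- The steps that generate the pairs `(n, c)` where `c` is the code of a provable formula in `n`
variables, if `A` is the set of codes of the axioms of a theory. The disjuncts correspond to the
axioms and rules of the Hilbert calculus. -/
def PrStep (A : ℕ → Prop) (q : List (ℕ × ℕ) × ℕ × ℕ) : Prop :=
  (∃ s, A s ∧ Gen FmStep ((0, q.2.1 + 1, 0), 0, s, q.2.2)) ∨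
  (∃ a b, IsFm q.2.1 a ∧ IsFm q.2.1 b ∧
    q.2.2 = Nat.pair 3 (Nat.pair a (Nat.pair 3 (Nat.pair b a)))) ∨
  (∃ a b c, IsFm q.2.1 a ∧ IsFm q.2.1 b ∧ IsFm q.2.1 c ∧
    q.2.2 = Nat.pair 3 (Nat.pair (Nat.pair 3 (Nat.pair a (Nat.pair 3 (Nat.pair b c))))
      (Nat.pair 3 (Nat.pair (Nat.pair 3 (Nat.pair a b)) (Nat.pair 3 (Nat.pair a c)))))) ∨
  (∃ a, IsFm q.2.1 a ∧ q.2.2 = Nat.pair 3 (Nat.pair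
    (Nat.pair 3 (Nat.pair (Nat.pair 3 (Nat.pair a (Nat.pair 0 0))) (Nat.pair 0 0))) a)) ∨
  (∃ a t d, IsTm q.2.1 t ∧ Gen FmStep ((q.2.1, 0, t), q.2.1 + 1, a, d) ∧
    q.2.2 = Nat.pair 3 (Nat.pair (Nat.pair 4 a) d)) ∨
  (∃ a b, IsFm (q.2.1 + 1) a ∧ IsFm (q.2.1 + 1) b ∧
    q.2.2 = Nat.pair 3 (Nat.pair (Nat.pair 4 (Nat.pair 3 (Nat.pair a b)))
      (Nat.pair 3 (Nat.pair (Nat.pair 4 a) (Nat.pair 4 b))))) ∨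
  (∃ a d, Gen FmStep ((q.2.1, 2, 0), q.2.1, a, d) ∧
    q.2.2 = Nat.pair 3 (Nat.pair a (Nat.pair 4 d))) ∨
  (∃ t, IsTm q.2.1 t ∧ q.2.2 = Nat.pair 1 (Nat.pair t t)) ∨
  (∃ s t a d d', IsTm q.2.1 s ∧ IsTm q.2.1 t ∧ Gen FmStep ((q.2.1, 0, s), q.2.1 + 1, a, d) ∧
    Gen FmStep ((q.2.1, 0, t), q.2.1 + 1, a, d') ∧
    q.2.2 = Nat.pair 3 (Nat.pair (Nat.pair 1 (Nat.pair s t)) (Nat.pair 3 (Nat.pair d d')))) ∨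
  (∃ a, (q.2.1, Nat.pair 3 (Nat.pair a q.2.2)) ∈ q.1 ∧ (q.2.1, a) ∈ q.1) ∨
  ∃ a, (q.2.1 + 1, a) ∈ q.1 ∧ q.2.2 = Nat.pair 4 a

variable {A : ℕ → Prop} {k : ℕ}

theorem sig_prStep (hA : Sig (k + 1) A) : Sig (k + 1) (PrStep A) := by
  unfold PrStep IsFm IsTm
  repeat' first
    | apply Sig.or | apply Sig.exists' | apply Sig.and | apply Sig.mem | apply Sig.eq
    | apply sig_gen_tmStep.comp | apply sig_gen_fmStep.comp | apply hA.comp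
  all_goals fun_prop

theorem PrStep.mono (l l' : List (ℕ × ℕ)) (a) (h : l ⊆ l') (hs : PrStep A (l, a)) :
    PrStep A (l', a) := by
  rcases hs with hs | hs | hs | hs | hs | hs | hs | hs | hs | ⟨a, h1, h2⟩ | ⟨a, h1, h2⟩
  · exact .inl hs
  · exact .inr (.inl hs)
  · exact .inr (.inr (.inl hs))
  · exact .inr (.inr (.inr (.inl hs)))
  · exact .inr (.inr (.inr (.inr (.inl hs))))
  · exact .inr (.inr (.inr (.inr (.inr (.inl hs)))))
  · exact .inr (.inr (.inr (.inr (.inr (.inr (.inl hs))))))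
  · exact .inr (.inr (.inr (.inr (.inr (.inr (.inr (.inl hs)))))))
  · exact .inr (.inr (.inr (.inr (.inr (.inr (.inr (.inr (.inl hs))))))))
  · exact .inr (.inr (.inr (.inr (.inr (.inr (.inr (.inr (.inr (.inl ⟨a, h h1, h h2⟩)))))))))
  · exact .inr (.inr (.inr (.inr (.inr (.inr (.inr (.inr (.inr (.inr ⟨a, h h1, h2⟩)))))))))

/-- Provability is generated by `PrStep`. -/
theorem gen_prStep_iff {T : L.Theory} {n c : ℕ} :
    Gen (PrStep fun s => ∃ σ ∈ T, code (n := 0) σ = s) (n, c) ↔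
      ∃ φ : Fm n, code φ = c ∧ Provable T φ := by
  constructor
  · intro h
    generalize hq : (n, c) = q at h
    induction h generalizing n c with
    | mk l q _ hs ih =>
      subst hq
      rcases hs with ⟨s, ⟨σ, hσ, rfl⟩, h⟩ | ⟨a, b, ha, hb, h⟩ | ⟨a, b, d, ha, hb, hd, h⟩ |
        ⟨a, ha, h⟩ | ⟨a, t, d, ht, ha, h⟩ | ⟨a, b, ha, hb, h⟩ | ⟨a, d, ha, h⟩ | ⟨t, ht, h⟩ |
        ⟨s, t, a, d, d', hs, ht, ha, ha', h⟩ | ⟨a, ha, hb⟩ | ⟨a, ha, h⟩ <;> dsimp only at *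
      · obtain ⟨σ', h1, rfl⟩ := gen_fmStep_iff.1 h
        cases code_inj h1
        exact ⟨_, code_subst_elim0 σ, .ax σ hσ⟩
      · obtain ⟨φ, rfl⟩ := isFm_iff.1 ha
        obtain ⟨ψ, rfl⟩ := isFm_iff.1 hb
        exact ⟨_, by simp [h], .imp_intro φ ψ⟩
      · obtain ⟨φ, rfl⟩ := isFm_iff.1 ha
        obtain ⟨ψ, rfl⟩ := isFm_iff.1 hb
        obtain ⟨χ, rfl⟩ := isFm_iff.1 hd
        exact ⟨_, by simp [h], .imp_distrib φ ψ χ⟩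
      · obtain ⟨φ, rfl⟩ := isFm_iff.1 ha
        exact ⟨_, by simp [h], .not_not φ⟩
      · obtain ⟨t, rfl⟩ := isTm_iff.1 ht
        obtain ⟨φ, rfl, rfl⟩ := gen_fmStep_iff.1 ha
        exact ⟨_, by simp [h, code_inst], .all_inst φ t⟩
      · obtain ⟨φ, rfl⟩ := isFm_iff.1 ha
        obtain ⟨ψ, rfl⟩ := isFm_iff.1 hb
        exact ⟨_, by simp [h], .all_imp φ ψ⟩
      · obtain ⟨φ, rfl, rfl⟩ := gen_fmStep_iff.1 ha
        exact ⟨_, by simp [h, code_lift], .all_intro φ⟩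
      · obtain ⟨t, rfl⟩ := isTm_iff.1 ht
        exact ⟨_, by simp [h], .eq_refl t⟩
      · obtain ⟨s, rfl⟩ := isTm_iff.1 hs
        obtain ⟨t, rfl⟩ := isTm_iff.1 ht
        obtain ⟨φ, rfl, rfl⟩ := gen_fmStep_iff.1 ha
        obtain ⟨ψ, h1, rfl⟩ := gen_fmStep_iff.1 ha'
        cases code_inj h1
        exact ⟨_, by simp [h, code_inst], .eq_subst s t φ⟩
      · obtain ⟨φ, h1, hφ⟩ := ih _ ha rfl
        obtain ⟨ψ, rfl, hψ⟩ := ih _ hb rfl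
        obtain ⟨φ₁, φ₂, rfl, h2, rfl⟩ := exists_imp_of_code h1
        cases code_inj h2
        exact ⟨φ₂, rfl, .mp hφ hψ⟩
      · obtain ⟨φ, rfl, hφ⟩ := ih _ ha rfl
        exact ⟨_, by simp [h], .gen hφ⟩
  · rintro ⟨φ, rfl, h⟩
    induction h with
    | ax σ hσ =>
      exact .mk [] _ (by simp) (.inl ⟨_, ⟨σ, hσ, rfl⟩,
        gen_fmStep_iff.2 ⟨σ, rfl, (code_subst_elim0 σ).symm⟩⟩)
    | imp_intro φ ψ =>
      exact .mk [] _ (by simp) (.inr (.inl ⟨_, _, isFm_iff.2 ⟨φ, rfl⟩, isFm_iff.2 ⟨ψ, rfl⟩,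
        by simp⟩))
    | imp_distrib φ ψ χ =>
      exact .mk [] _ (by simp) (.inr (.inr (.inl ⟨_, _, _, isFm_iff.2 ⟨φ, rfl⟩,
        isFm_iff.2 ⟨ψ, rfl⟩, isFm_iff.2 ⟨χ, rfl⟩, by simp⟩)))
    | not_not φ =>
      exact .mk [] _ (by simp) (.inr (.inr (.inr (.inl ⟨_, isFm_iff.2 ⟨φ, rfl⟩, by simp⟩))))
    | all_inst φ t =>
      exact .mk [] _ (by simp) (.inr (.inr (.inr (.inr (.inl ⟨_, _, _, isTm_iff.2 ⟨t, rfl⟩,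
        gen_fmStep_iff.2 ⟨φ, rfl, (code_inst φ t).symm⟩, by simp⟩)))))
    | all_imp φ ψ =>
      exact .mk [] _ (by simp) (.inr (.inr (.inr (.inr (.inr (.inl ⟨_, _, isFm_iff.2 ⟨φ, rfl⟩,
        isFm_iff.2 ⟨ψ, rfl⟩, by simp⟩))))))
    | all_intro φ =>
      exact .mk [] _ (by simp) (.inr (.inr (.inr (.inr (.inr (.inr (.inl ⟨_, _,
        gen_fmStep_iff.2 ⟨φ, rfl, (code_lift φ).symm⟩, by simp⟩)))))))
    | eq_refl t =>
      exact .mk [] _ (by simp) (.inr (.inr (.inr (.inr (.inr (.inr (.inr (.inl ⟨_,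
        isTm_iff.2 ⟨t, rfl⟩, by simp⟩))))))))
    | eq_subst s t φ =>
      exact .mk [] _ (by simp) (.inr (.inr (.inr (.inr (.inr (.inr (.inr (.inr (.inl ⟨_, _, _, _, _,
        isTm_iff.2 ⟨s, rfl⟩, isTm_iff.2 ⟨t, rfl⟩,
        gen_fmStep_iff.2 ⟨φ, rfl, (code_inst φ s).symm⟩,
        gen_fmStep_iff.2 ⟨φ, rfl, (code_inst φ t).symm⟩, by simp⟩)))))))))
    | @mp n φ ψ _ _ h1 h2 =>
      exact .mk [_, _] _ (by simpa using ⟨h1, h2⟩) (.inr (.inr (.inr (.inr (.inr (.inr (.inr (.inr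
        (.inr (.inl ⟨code φ, by simp, by simp⟩))))))))))
    | @gen n φ _ h =>
      exact .mk [_] _ (by simpa using h) (.inr (.inr (.inr (.inr (.inr (.inr (.inr (.inr
        (.inr (.inr ⟨code φ, by simp, by simp⟩))))))))))

theorem sig_axioms {T : L.Theory} (h : Definable .sigma k T) :
    Sig k fun s => ∃ σ ∈ T, code (n := 0) σ = s := by
  obtain ⟨θ, hθ, h⟩ := h
  have h1 : Primrec fun s : ℕ => ![s] :=
    Primrec.fin_curry.2 (Primrec₂.swap (Primrec.fin_curry₁.2 fun i => by
      fin_cases i; exact .id))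
  exact (Sig.comp (P := Holds θ) hθ.sig h1).of_iff fun s => (h s).symm

@[fun_prop] theorem primrec_codeTm_numeral {α : Type} [Primcodable α] {f : α → ℕ} {n : ℕ}
    (hf : Primrec f) : Primrec fun a => codeTm (numeral (f a) : Tm n) := by
  have h : Primrec fun m => codeTm (numeral m : Tm n) := by
    refine (Primrec.nat_rec₁ (f := fun _ c => Nat.pair 2 c) (Nat.pair 1 0)
      (Primrec₂.natPair.comp (.const 2) .snd)).of_eq fun m => ?_
    induction m with
    | zero => simp [numeral]
    | succ m ih => simp [numeral, ← ih]
  exact h.comp hf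

/-- For a `Σₖ`-definable theory, `k ≥ 1`, it is a `Σₖ`-predicate of `φ` that the instance of `φ` at
its own Gödel number is provable. -/
theorem sig_provable_diag {T : L.Theory} (h : Definable .sigma (k + 1) T) :
    Sig (k + 1) fun m => ∃ φ : Fm 1, code φ = m ∧ Provable T (inst φ (numeral m)) := by
  have hp := (sig_prStep (sig_axioms h)).gen PrStep.mono
  have h1 : Sig (k + 1) fun m => ∃ d, Gen FmStep ((0, 0, codeTm (numeral m : Tm 0)), 1, m, d) ∧
      Gen (PrStep fun s => ∃ σ ∈ T, code (n := 0) σ = s) (0, d) := by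
    refine .exists' (.and (sig_gen_fmStep.comp ?_) (hp.comp ?_)) <;> fun_prop
  refine h1.of_iff fun m => ?_
  simp only [gen_fmStep_iff, gen_prStep_iff]
  constructor
  · rintro ⟨φ, h1, h2⟩
    exact ⟨_, ⟨φ, h1, (code_inst φ _).symm⟩, _, rfl, h2⟩
  · rintro ⟨_, ⟨φ, h1, rfl⟩, ψ, h2, h3⟩
    rw [← code_inst φ (numeral m)] at h2
    exact ⟨φ, h1, code_inj h2 ▸ h3⟩

/-- For a `Σₖ`-definable theory, `k ≥ 1`, it is a `Σₖ`-predicate of `φ` that the instance of `φ` at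
its own Gödel number is refutable. -/
theorem sig_refutable_diag {T : L.Theory} (h : Definable .sigma (k + 1) T) :
    Sig (k + 1) fun m => ∃ φ : Fm 1, code φ = m ∧ Provable T (inst φ (numeral m)).not := by
  have hp := (sig_prStep (sig_axioms h)).gen PrStep.mono
  have h1 : Sig (k + 1) fun m => ∃ d, Gen FmStep ((0, 0, codeTm (numeral m : Tm 0)), 1, m, d) ∧
      Gen (PrStep fun s => ∃ σ ∈ T, code (n := 0) σ = s)
        (0, Nat.pair 3 (Nat.pair d (Nat.pair 0 0))) := by
    refine .exists' (.and (sig_gen_fmStep.comp ?_) (hp.comp ?_)) <;> fun_prop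
  refine h1.of_iff fun m => ?_
  simp only [gen_fmStep_iff, gen_prStep_iff]
  constructor
  · rintro ⟨φ, h1, h2⟩
    exact ⟨_, ⟨φ, h1, (code_inst φ _).symm⟩, _, code_not _, h2⟩
  · rintro ⟨_, ⟨φ, h1, rfl⟩, ψ, h2, h3⟩
    rw [← code_inst φ (numeral m), ← code_not] at h2
    exact ⟨φ, h1, code_inj h2 ▸ h3⟩

end Provability

/-! ### Rosser's argument -/

/-- The formula `∀ z (π₁(x, z) → ∃ w ≤ z π₂(x, w))`. -/
def rosser (π₁ π₂ : Fm 2) : Fm 1 :=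
  (π₁.imp (bex (x 1) (subst π₂ ![x 0, x 2]))).all

theorem rosser_inClass {k : ℕ} {π₁ π₂ : Fm 2} (h₁ : Strict .pi k π₁) (h₂ : Strict .pi k π₂) :
    InClass .pi (k + 1) (rosser π₁ π₂) :=
  .all (.imp (.of_dual h₁.inClass) (.bex _ (h₂.inClass_succ.subst _)))

section Rosser

variable {T : L.Theory} {π₁ π₂ : Fm 2} {e : ℕ}

theorem inst_rosser (π₁ π₂ : Fm 2) (e : ℕ) :
    inst (rosser π₁ π₂) (numeral e) =
      ((subst π₁ ![numeral e, x 0]).imp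
        (bex (x 0) (subst π₂ ![numeral e, x 1]))).all := by
  have h : (Fin.snoc x (numeral e) : Fin 1 → Tm 0) = ![numeral e] := by
    funext i; fin_cases i; rfl
  rw [rosser, inst, h, subst_all, under_one, liftTm_numeral, subst_imp, subst_bex, subst_subst,
    under_two]
  congr 4
  · funext i
    fin_cases i <;> simp

theorem numInst_two (φ : Fm 2) (e z : ℕ) :
    numInst φ ![e, z] = subst φ ![numeral e, numeral z] := by
  rw [numInst]
  congr 1
  funext i
  fin_cases i <;> rfl

theorem inst_one (φ : Fm 2) (e z : ℕ) :
    inst (subst φ ![numeral e, x 0] : Fm 1) (numeral z) = numInst φ ![e, z] := by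
  rw [numInst_two, inst, subst_subst]
  congr 1
  funext i
  fin_cases i
  · simp
  · rfl

theorem inst_bex_two (φ : Fm 2) (e z : ℕ) :
    inst (bex (x 0) (subst φ ![numeral e, x 1]) : Fm 1) (numeral z) =
      bex (numeral z) (subst φ ![numeral e, x 0]) := by
  rw [inst, subst_bex, subst_subst]
  congr 2
  funext i
  fin_cases i
  · simp
  · rfl

theorem inst_two (φ : Fm 2) (e z : ℕ) :
    inst (subst φ ![numeral e, x 1] : Fm 2) (numeral z) =
      subst (numInst φ ![e, z]) Fin.elim0 := by
  rw [numInst_two, inst, subst_subst, subst_subst]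
  congr 1
  funext i
  fin_cases i
  · simp
  · simpa using (show substTm (x 1) (Fin.snoc x (numeral z) : Fin 2 → Tm 1) = numeral z from rfl)

/-- If `π₁(e, k)` is provable and `π₂(e, w)` is refutable for all `w ≤ k`, then the Rosser sentence
is refutable. -/
theorem provable_not_rosser (hQ : Extends T Q) {k : ℕ} (h₁ : Provable T (numInst π₁ ![e, k]))
    (h₂ : ∀ w ≤ k, Provable T (numInst π₂ ![e, w]).not) :
    Provable T (inst (rosser π₁ π₂) (numeral e)).not := by
  rw [inst_rosser]
  refine (Ent.not_intro (H := []) ?_).provable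
  refine .not_elim (φ := bex (numeral k) (subst π₂ ![numeral e, x 0]))
    (.thm (.not_bex hQ (.refl _) fun w hw => ?_)) ?_
  · rw [inst_one]; exact h₂ w hw
  · rw [← inst_bex_two]
    refine .mp (φ := inst (subst π₁ ![numeral e, x 0]) (numeral k)) ?_ ?_
    · rw [← inst_imp]
      exact .all_elim .head _
    · rw [inst_one]; exact .thm h₁

/-- If `π₂(e, k)` is provable and `π₁(e, z)` is refutable for all `z ≤ k`, then the Rosser sentence
is provable, as every `z` is comparable with `k`. -/
theorem provable_rosser (hQ : Extends T Q) {k : ℕ} (h₂ : Provable T (numInst π₂ ![e, k]))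
    (h₁ : ∀ z ≤ k, Provable T (numInst π₁ ![e, z]).not) :
    Provable T (inst (rosser π₁ π₂) (numeral e)) := by
  rw [inst_rosser]
  refine .gen (Ent.deduct (.le_numeral_or hQ k (x 0) ?_ ?_)).provable
  · refine .exfalso (.le_numeral_cases hQ k .head fun z hz => ?_)
    refine .not_elim (φ := subst π₁ ![numeral e, x 0]) (.of_inst (t := numeral z) ?_ ?_)
      (.hyp (by simp))
    · rw [liftTm_numeral]; exact .head
    · rw [inst_not, inst_one]
      exact .thm ((h₁ z hz).subst _)
  · refine .bex_intro (numeral k) .head ?_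
    rw [inst_two]
    exact .thm (h₂.subst _)

end Rosser

end Arith

theorem mainTheorem2 (n : ℕ) (hn : 1 ≤ n) (T : Arith.L.Theory)
    (hdef : Arith.Definable .sigma n T) (hQ : Arith.Extends T Arith.Q)
    (hcon : Arith.NConsistent (n - 1) T) :
    ¬ Arith.Deciding .pi n T := by
  obtain ⟨k, rfl⟩ := Nat.exists_eq_add_of_le' hn
  rw [Nat.add_sub_cancel] at hcon
  intro hdec
  have hv : Primrec fun v : Fin 1 → ℕ => v 0 := Primrec.fin_app.comp .id (.const 0)
  have hsnoc : ∀ e z : ℕ, (Fin.snoc ![e] z : Fin 2 → ℕ) = ![e, z] := fun e z => by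
    funext i; fin_cases i <;> rfl
  obtain ⟨π₁, hπ₁, h₁⟩ := ((Arith.sig_provable_diag hdef).comp hv).exists_strict_pi
  obtain ⟨π₂, hπ₂, h₂⟩ := ((Arith.sig_refutable_diag hdef).comp hv).exists_strict_pi
  have d₁ := hπ₁.decides hQ hcon hdec le_rfl
  have d₂ := hπ₂.decides hQ hcon hdec le_rfl
  -- the Rosser sentence is `ρ(e)` for the formula `ρ(x)` with Gödel number `e`
  obtain ⟨ρ, hρ⟩ : ∃ ρ, ρ = Arith.rosser π₁ π₂ := ⟨_, rfl⟩
  obtain ⟨e, he⟩ : ∃ e, Arith.code ρ = e := ⟨_, rfl⟩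
  have h₁' : Arith.Provable T (Arith.inst ρ (Arith.numeral e)) ↔
      ∃ z, Arith.Holds π₁ ![e, z] := by
    have h := h₁ ![e]
    simp only [hsnoc, Matrix.cons_val_zero] at h
    rw [← h]
    exact ⟨fun h => ⟨ρ, he, h⟩, fun ⟨φ, h1, h2⟩ => Arith.code_inj (h1.trans he.symm) ▸ h2⟩
  have h₂' : Arith.Provable T (Arith.inst ρ (Arith.numeral e)).not ↔
      ∃ z, Arith.Holds π₂ ![e, z] := by
    have h := h₂ ![e]
    simp only [hsnoc, Matrix.cons_val_zero] at h
    rw [← h]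
    exact ⟨fun h => ⟨ρ, he, h⟩, fun ⟨φ, h1, h2⟩ => Arith.code_inj (h1.trans he.symm) ▸ h2⟩
  have hnot : ¬ (Arith.Provable T (Arith.inst ρ (Arith.numeral e)) ∧
      Arith.Provable T (Arith.inst ρ (Arith.numeral e)).not) :=
    fun h => hcon.consistent (.mp h.2 h.1)
  rcases hdec _ ((hρ ▸ Arith.rosser_inClass hπ₁ hπ₂).subst _ :
      Arith.InClass .pi (k + 1) (Arith.inst ρ (Arith.numeral e))) with h | h
  · obtain ⟨z, hz⟩ := h₁'.1 h
    refine hnot ⟨h, hρ ▸ Arith.provable_not_rosser hQ ((d₁ _).1 hz)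
      fun w _ => (d₂ _).2 fun hw => ?_⟩
    exact hnot ⟨h, h₂'.2 ⟨w, hw⟩⟩
  · obtain ⟨w, hw⟩ := h₂'.1 h
    refine hnot ⟨hρ ▸ Arith.provable_rosser hQ ((d₂ _).1 hw) fun z _ => (d₁ _).2 fun hz => ?_, h⟩
    exact hnot ⟨h₁'.2 ⟨z, hz⟩, h⟩
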